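/- Let $\alpha\ge 0$, $\sigma\ge 0$ and let $\pi$ be a measure on $(0,\infty)$ with $\int_{(0,\infty)} (r\wedge r^2)\,\pi(dr)<\infty$. Put $$\psi(\lambda)=\alpha\lambda+\tfrac12\sigma^2\lambda^2+\int_{(0,\infty)}\left(e^{-\lambda r}-1+\lambda r\right)\pi(dr),\qquad \lambda\ge 0,$$ and assume that $\psi$ is positive near $+\infty$ and $\int^{+\infty}\frac{d\lambda}{\psi(\lambda)}<\infty$. Let $((Z_t)_{t\ge0},(\mathbb P_x)_{x\ge0})$ be a continuous-state branching process with branching mechanism $\psi$, that is, a $[0,\infty)$-valued time-homogeneous Markov process with càdlàg paths and absorbing state $0$, with $\mathbb P_x(Z_0=x)=1$ and $\mathbb E_x[e^{-\lambda Z_t}]=e^{-xu_t(\lambda)}$ for $\lambda>0$, where $u_t(\lambda)\ge 0$ solves $\partial_t u_t(\lambda)=-\psi(u_t(\lambda))$, $u_0(\lambda)=\lambda$. Let $\zeta=\inf\{t>0: Z_t=0\}$ and, for $0<q<t$ and $x>0$, let $\mathbb P_x(Z_{t-q}\in\cdot\mid\zeta=t)$ be the probability measure with $$\mathbb P_x(Z_{t-q}\in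 A\mid\zeta=t)=\lim_{s\to0+}\mathbb P_x(Z_{t-q}\in A\mid t\le\zeta<t+s)\quad\text{for every Borel set } A.$$ For $q>0$ let $V_q$ denote a random variable whose law is, for every $x>0$, the weak limit of $\mathbb P_x(Z_{t-q}\in\cdot\mid\zeta=t)$ as $t\to\infty$, and let $V_\infty$ denote the limit in distribution of $V_q$ as $q\to\infty$ (when it exists). For $x>0$ let $Z^{\uparrow}$ be the $Q$-process (the process conditioned on non-extinction) started from $x$: the process whose law is the $h$-transform of $\mathbb P_x$ based on the martingale $M_t=Z_te^{\alpha t}$, that is, $d\mathbb P^{\uparrow}_x/d\mathbb P_x=M_t/M_0$ on $\mathcal F_t=\sigma(Z_s,\,s\le t)$ for every $t\ge 0$. Consider the condition $$(\ast)\qquad \alpha>0\quad\text{and}\quad\int^{+\infty} r\log r\,\pi(dr)<\infty .$$ (1) If $(\ast)$ holds, then the limit $V_\infty$ exists and is a.s. positive and finite, it does not depend on $x$, and for every $x>0$, $Z^{\uparrow}_t$ converges in distribution to $V_\infty$ as $t\to\infty$. (2) If $(\ast)$ fails, then for every $x>0$, $Z^{\uparrow}_t\to\infty$ in probability as $t\to\infty$,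 that is, $\mathbb P^{\uparrow}_x(Z^{\uparrow}_t>M)\to1$ for every $M\ge 0$. -/

import Mathlib

open MeasureTheory ProbabilityTheory Filter Topology Set
open scoped NNReal ENNReal

noncomputable section

/-- The parameters of the (finite mean) branching mechanism of a continuous-state branching process:
a drift `α`, a diffusion coefficient `σ ≥ 0`, and a measure `π` on `(0, ∞)` with
`∫ min r (r ^ 2) π(dr) < ∞`. In particular, `π` is finite on every compact subset of `(0, ∞)`. -/
structure BranchingMechanism where
  α : ℝ
  σ : ℝ
  σ_nonneg : 0 ≤ σ
  π : Measure ℝ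
  π_Iic : π (Iic 0) = 0
  lintegral_lt_top : ∫⁻ r, ENNReal.ofReal (min r (r ^ 2)) ∂π < ⊤

namespace BranchingMechanism

/-- `ψ(l) = α l + σ² l² / 2 + ∫_{(0, ∞)} (exp(-l r) - 1 + l r) π(dr)` (used for `l ≥ 0`). -/
def psi (B : BranchingMechanism) (l : ℝ) : ℝ :=
  B.α * l + 1 / 2 * B.σ ^ 2 * l ^ 2 + ∫ r in Ioi (0 : ℝ), (Real.exp (-l * r) - 1 + l * r) ∂B.π

/-- `∫^∞ dl / ψ(l) < ∞`: near infinity, `ψ` is positive and `1 / ψ` is integrable. -/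
def GreyCondition (B : BranchingMechanism) : Prop :=
  ∃ c : ℝ, 0 < c ∧ (∀ l, c ≤ l → 0 < B.psi l) ∧ IntegrableOn (fun l => 1 / B.psi l) (Ioi c)

/-- `α > 0` and `∫^∞ r log r π(dr) < ∞`. -/
def LLogLCondition (B : BranchingMechanism) : Prop :=
  0 < B.α ∧ ∫⁻ r in Ioi (1 : ℝ), ENNReal.ofReal (r * Real.log r) ∂B.π < ⊤

/-- `u l t` is `u_t(l)`: for every `l > 0`, the function `t ↦ u_t(l)` is the nonnegative solution on
`[0, ∞)` of `∂u_t(l)/∂t = - ψ(u_t(l))`, `u_0(l) = l`. -/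
def IsCumulant (B : BranchingMechanism) (u : ℝ → ℝ → ℝ) : Prop :=
  ∀ l : ℝ, 0 < l → u l 0 = l ∧
    ∀ t : ℝ, 0 ≤ t → 0 ≤ u l t ∧ HasDerivWithinAt (u l) (-B.psi (u l t)) (Ici 0) t

end BranchingMechanism

/-- The path of the process `Z` on `[0, t]`. The events of `σ(Z s, s ≤ t)` are exactly the
preimages under `pathUpTo Z t` of the measurable sets of the product space. -/
def pathUpTo {Ω : Type*} (Z : ℝ≥0 → Ω → ℝ≥0) (t : ℝ≥0) (ω : Ω) : Iic t → ℝ≥0 :=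
  fun s => Z s ω

/-- `Z`, under the probability measures `P x` (`x ≥ 0`), is a continuous-state branching process
with branching mechanism `B.psi`: a `[0, ∞)`-valued time-homogeneous Markov process (with respect
to the filtration that it generates) with càdlàg paths, started from `x` under `P x`, absorbed
at `0`, with `E_x[exp(-l Z_t)] = exp(-x u_t(l))`. -/
structure IsCBProcess (B : BranchingMechanism) {Ω : Type*} [MeasurableSpace Ω]
    (Z : ℝ≥0 → Ω → ℝ≥0) (P : Kernel ℝ≥0 Ω) : Prop where
  isMarkovKernel : IsMarkovKernel P
  measurable : ∀ t, Measurable (Z t)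
  cadlag : ∀ x, ∀ᵐ ω ∂P x, ∀ t, ContinuousWithinAt (fun s => Z s ω) (Ici t) t ∧
    ∃ l, Tendsto (fun s => Z s ω) (𝓝[<] t) (𝓝 l)
  start : ∀ x, ∀ᵐ ω ∂P x, Z 0 ω = x
  absorbed : ∀ x, ∀ᵐ ω ∂P x, ∀ s t, s ≤ t → Z s ω = 0 → Z t ω = 0
  markov : ∀ (x s t : ℝ≥0) (A : Set (Iic s → ℝ≥0)) (C : Set ℝ≥0),
    MeasurableSet A → MeasurableSet C →
      P x (pathUpTo Z s ⁻¹' A ∩ Z (s + t) ⁻¹' C) =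
        ∫⁻ ω in pathUpTo Z s ⁻¹' A, P (Z s ω) (Z t ⁻¹' C) ∂P x
  laplace : ∃ u, B.IsCumulant u ∧ ∀ (x t : ℝ≥0) (l : ℝ), 0 < l →
    ∫ ω, Real.exp (-l * Z t ω) ∂P x = Real.exp (-(x * u l t))

/-- The extinction time `inf {t > 0 : Z t = 0}`, with `inf ∅ = ∞`. -/
def extinctionTime {Ω : Type*} (Z : ℝ≥0 → Ω → ℝ≥0) (ω : Ω) : ℝ≥0∞ :=
  ⨅ (t : ℝ≥0) (_ : 0 < t ∧ Z t ω = 0), (t : ℝ≥0∞)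

/-- `ν = P_x(Z_{t-q} ∈ · | ζ = t)`, where `ζ` is the extinction time and `0 < q < t`, that is,
`ν(A)` is the limit of `P_x(Z_{t-q} ∈ A | t ≤ ζ < t + s)` as `s ↓ 0`, for every Borel set `A`. -/
def IsLawGivenExtinctionAt {Ω : Type*} [MeasurableSpace Ω] (Z : ℝ≥0 → Ω → ℝ≥0)
    (P : Kernel ℝ≥0 Ω) (x q t : ℝ≥0) (ν : ProbabilityMeasure ℝ≥0) : Prop :=
  ∀ A : Set ℝ≥0, MeasurableSet A →
    Tendsto (fun s : ℝ≥0 =>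
        ProbabilityTheory.cond (P x) {ω | (t : ℝ≥0∞) ≤ extinctionTime Z ω ∧ extinctionTime Z ω < ((t + s : ℝ≥0) : ℝ≥0∞)}
          (Z (t - q) ⁻¹' A))
      (𝓝[>] 0) (𝓝 ((ν : Measure ℝ≥0) A))

/-- `V` is the law of `V_q`: for every starting point `x > 0`, the law of `Z_{t-q}` given `ζ = t`
converges weakly to `V` as `t → ∞`. -/
def IsLawOfV {Ω : Type*} [MeasurableSpace Ω] (Z : ℝ≥0 → Ω → ℝ≥0)
    (P : Kernel ℝ≥0 Ω) (q : ℝ≥0) (V : ProbabilityMeasure ℝ≥0) : Prop :=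
  ∀ x : ℝ≥0, 0 < x → ∃ K : ℝ≥0 → ProbabilityMeasure ℝ≥0,
    (∀ t, q < t → IsLawGivenExtinctionAt Z P x q t (K t)) ∧ Tendsto K atTop (𝓝 V)

/-- `Vinf` is the law of `V_∞`, the limit in distribution of `V_q` as `q → ∞`. -/
def IsLawOfVInfty {Ω : Type*} [MeasurableSpace Ω] (Z : ℝ≥0 → Ω → ℝ≥0)
    (P : Kernel ℝ≥0 Ω) (Vinf : ProbabilityMeasure ℝ≥0) : Prop :=
  ∃ V : ℝ≥0 → ProbabilityMeasure ℝ≥0,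
    (∀ q, 0 < q → IsLawOfV Z P q (V q)) ∧ Tendsto V atTop (𝓝 Vinf)

/-- The process `Y`, on the probability space `(Ω', Q)`, is a `Q`-process `Z^↑` started from
`x > 0`: its law is the `h`-transform of the law of `Z` under `P x` based on the martingale
`M_t = Z_t exp(α t)`. That is, for every `t` and every event depending on the path on `[0, t]`,
`Q(Y|_{[0, t]} ∈ A) = E_x[M_t / x ; Z|_{[0, t]} ∈ A]`. -/
structure IsQProcess (α : ℝ) {Ω : Type*} [MeasurableSpace Ω] (Z : ℝ≥0 → Ω → ℝ≥0)
    (P : Kernel ℝ≥0 Ω) (x : ℝ≥0) {Ω' : Type*} [MeasurableSpace Ω']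
    (Y : ℝ≥0 → Ω' → ℝ≥0) (Q : Measure Ω') : Prop where
  measurable : ∀ t, Measurable (Y t)
  law : ∀ (t : ℝ≥0) (A : Set (Iic t → ℝ≥0)), MeasurableSet A →
    Q (pathUpTo Y t ⁻¹' A) =
      ∫⁻ ω in pathUpTo Z t ⁻¹' A, ENNReal.ofReal (Z t ω * Real.exp (α * t) / x) ∂P x

end

noncomputable section

/-! Write φ(x) = ∫_x^∞ dl/ψ(l) (`greyIntegral`) and v for its inverse (`flow`). Separating variables
in the cumulant equation gives u_t(l) = v(t + φ(l)), so v' = -ψ(v) and P_x(Z_t = 0) = exp(-x v(t)).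
Differentiating the Laplace transform yields the identity on which everything rests
(`integral_mul_exp_flow`, `integral_mul_exp`): E_x[Z_t exp(-m Z_t)] = x ψ(v(t + φ(m))) / ψ(m) ·
exp(-x v(t + φ(m))).

For the Q-process, E[exp(-m Z^↑_t)] is this quantity times exp(α t)/x. If exp(α t) ψ(v(t)) → w, it
tends to L(m) = w/ψ(m) · exp(-α φ(m)) (`limitLaplace`). For V_q, the Markov property at time t - q
shows that conditioning on ζ = t biases the law of Z_{t-q} by y exp(-v(q) y)
(`exists_isLawGivenExtinctionAt`). The same identity gives the Laplace transform of V_q when w > 0,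
and it tends to the same L as q → ∞. Both halves thus reduce to deciding whether w is positive or
zero.

When α > 0, set f(l) = log l + α φ(l), so that exp(α t) v(t) = exp(f(v(t))). Here f'(l) = (ψ(l) - α
l)/(l ψ(l)) ≥ 0, and ψ(l) is comparable to l near 0. Hence f has a finite limit at 0+ exactly when
(ψ(l) - α l)/l² is integrable near 0, which by Tonelli is the r log r condition
(`lintegral_excess_exp_lt_top_iff`); otherwise f → -∞. As ψ(l) ~ α l, w is positive or zero
accordingly. If α = 0, then w = lim ψ(v(t)) = 0.

If w > 0, then L(0+) = 1 and L(∞) = 0, so the limit law is a probability on (0, ∞). If w = 0, the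
Laplace transforms of the Q-process vanish in the limit, so it escapes to infinity. -/

/-! ### Bounds on ψ and its behaviour at 0 -/

lemma exp_neg_sub_one_add_nonneg (y : ℝ) : 0 ≤ Real.exp (-y) - 1 + y := by
  linarith [Real.add_one_le_exp (-y)]

lemma exp_neg_sub_one_add_le_self {y : ℝ} (hy : 0 ≤ y) : Real.exp (-y) - 1 + y ≤ y := by
  linarith [Real.exp_le_one_iff.2 (neg_nonpos.2 hy)]

lemma exp_neg_sub_one_add_le_sq {y : ℝ} (hy : 0 ≤ y) : Real.exp (-y) - 1 + y ≤ y ^ 2 := by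
  rcases le_total y 1 with h | h
  · have := Real.abs_exp_sub_one_sub_id_le (x := -y) (by rwa [abs_neg, abs_of_nonneg hy])
    have := (abs_le.1 this).2
    nlinarith
  · nlinarith [exp_neg_sub_one_add_le_self hy]

/-- The factor `l` is kept explicit so that the bound still dominates after division by `l`; the
rest is uniform over `l ≤ M`. -/
lemma exp_neg_sub_one_add_le_min {l M r : ℝ} (hl : 0 ≤ l) (hlM : l ≤ M) (hr : 0 < r) :
    Real.exp (-l * r) - 1 + l * r ≤ l * (1 + M) * min r (r ^ 2) := by
  have hlr : 0 ≤ l * r := by positivity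
  have h1 := exp_neg_sub_one_add_le_self hlr
  have h2 := exp_neg_sub_one_add_le_sq hlr
  rw [neg_mul]
  have hM : 0 ≤ M := hl.trans hlM
  rcases min_cases r (r ^ 2) with ⟨h, -⟩ | ⟨h, -⟩ <;> rw [h]
  · nlinarith [mul_nonneg hlr hM]
  · have : (l * r) ^ 2 ≤ l * M * r ^ 2 := by
      have : l * (l * r ^ 2) ≤ l * (M * r ^ 2) := by gcongr
      nlinarith
    nlinarith [mul_nonneg hl (sq_nonneg r)]

namespace BranchingMechanism

lemma integrableOn_min (B : BranchingMechanism) :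
    IntegrableOn (fun r => min r (r ^ 2)) (Ioi 0) B.π := by
  refine ⟨by fun_prop, ?_⟩
  rw [hasFiniteIntegral_iff_ofReal]
  · exact (setLIntegral_le_lintegral _ _).trans_lt B.lintegral_lt_top
  · filter_upwards [ae_restrict_mem measurableSet_Ioi] with r hr
    have : 0 < r := hr
    positivity

lemma integrableOn_exp (B : BranchingMechanism) {l : ℝ} (hl : 0 ≤ l) :
    IntegrableOn (fun r => Real.exp (-l * r) - 1 + l * r) (Ioi 0) B.π := by
  refine Integrable.mono' (B.integrableOn_min.const_mul (l * (1 + l))) (by fun_prop) ?_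
  filter_upwards [ae_restrict_mem measurableSet_Ioi] with r hr
  rw [Real.norm_of_nonneg (by simpa using exp_neg_sub_one_add_nonneg (l * r))]
  exact exp_neg_sub_one_add_le_min hl le_rfl hr

/-- The part `ψ(l) - α l` of the branching mechanism. -/
def excess (B : BranchingMechanism) (l : ℝ) : ℝ :=
  1 / 2 * B.σ ^ 2 * l ^ 2 + ∫ r in Ioi (0 : ℝ), (Real.exp (-l * r) - 1 + l * r) ∂B.π

lemma psi_eq (B : BranchingMechanism) (l : ℝ) : B.psi l = B.α * l + B.excess l := by
  rw [psi, excess, add_assoc]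

lemma excess_nonneg (B : BranchingMechanism) (l : ℝ) : 0 ≤ B.excess l := by
  refine add_nonneg (by positivity) (integral_nonneg fun r => ?_)
  simpa using exp_neg_sub_one_add_nonneg (l * r)

lemma excess_zero (B : BranchingMechanism) : B.excess 0 = 0 := by simp [excess]

lemma psi_zero (B : BranchingMechanism) : B.psi 0 = 0 := by simp [psi_eq, excess_zero]

/-- A Lipschitz constant at `0` for `ψ` on `[0, M]`. -/
lemma exists_excess_le (B : BranchingMechanism) {M : ℝ} (hM : 0 ≤ M) :
    ∃ C : ℝ, 0 ≤ C ∧ ∀ l, 0 ≤ l → l ≤ M → B.excess l ≤ C * l := by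
  have hI : 0 ≤ ∫ r in Ioi (0 : ℝ), min r (r ^ 2) ∂B.π :=
    setIntegral_nonneg measurableSet_Ioi fun r (hr : 0 < r) => by positivity
  refine ⟨1 / 2 * B.σ ^ 2 * M + (1 + M) * ∫ r in Ioi (0 : ℝ), min r (r ^ 2) ∂B.π, by positivity,
    fun l hl hlM => ?_⟩
  have h1 : ∫ r in Ioi (0 : ℝ), (Real.exp (-l * r) - 1 + l * r) ∂B.π ≤
      l * (1 + M) * ∫ r in Ioi (0 : ℝ), min r (r ^ 2) ∂B.π := by
    rw [← integral_const_mul]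
    exact setIntegral_mono_on (B.integrableOn_exp hl) (B.integrableOn_min.const_mul _)
      measurableSet_Ioi fun r hr => exp_neg_sub_one_add_le_min hl hlM hr
  have h2 : 1 / 2 * B.σ ^ 2 * l ^ 2 ≤ 1 / 2 * B.σ ^ 2 * (M * l) := by
    gcongr; nlinarith
  rw [excess]
  linarith

lemma continuousOn_excess (B : BranchingMechanism) : ContinuousOn B.excess (Ici 0) := by
  refine ContinuousOn.add (by fun_prop) fun l hl => ?_
  have hl : 0 ≤ l := hl
  refine tendsto_integral_filter_of_dominated_convergence
    (fun r => (l + 1) * (1 + (l + 1)) * min r (r ^ 2)) (.of_forall fun _ => by fun_prop) ?_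
    (B.integrableOn_min.const_mul _) (.of_forall fun r => ?_)
  · have h1 : ∀ᶠ m in 𝓝[Ici 0] l, m < l + 1 :=
      mem_nhdsWithin_of_mem_nhds (Iio_mem_nhds (by linarith))
    filter_upwards [self_mem_nhdsWithin, h1] with m hm hm1
    filter_upwards [ae_restrict_mem measurableSet_Ioi] with r hr
    rw [Real.norm_of_nonneg (by simpa using exp_neg_sub_one_add_nonneg (m * r))]
    refine (exp_neg_sub_one_add_le_min hm hm1.le hr).trans ?_
    have : 0 < r := hr
    have : 0 ≤ m := hm
    gcongr
  · exact (Continuous.tendsto (by fun_prop) l).mono_left nhdsWithin_le_nhds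

lemma continuousOn_psi (B : BranchingMechanism) : ContinuousOn B.psi (Ici 0) := by
  have : B.psi = fun l => B.α * l + B.excess l := funext B.psi_eq
  rw [this]
  exact ContinuousOn.add (by fun_prop) B.continuousOn_excess

lemma tendsto_excess_div (B : BranchingMechanism) :
    Tendsto (fun l => B.excess l / l) (𝓝[>] 0) (𝓝 0) := by
  have h1 : Tendsto (fun l => 1 / 2 * B.σ ^ 2 * l) (𝓝[>] 0) (𝓝 0) := by
    refine (Continuous.tendsto' (by fun_prop) 0 0 (by simp)).mono_left nhdsWithin_le_nhds
  have h2 : Tendsto (fun l => ∫ r in Ioi (0 : ℝ), (Real.exp (-l * r) - 1 + l * r) / l ∂B.π)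
      (𝓝[>] 0) (𝓝 (∫ r in Ioi (0 : ℝ), (0 : ℝ) ∂B.π)) := by
    refine tendsto_integral_filter_of_dominated_convergence
      (fun r => 2 * min r (r ^ 2)) (.of_forall fun _ => by fun_prop) ?_
      (B.integrableOn_min.const_mul _) ?_
    · have h1 : ∀ᶠ m in 𝓝[>] (0 : ℝ), m < 1 :=
        mem_nhdsWithin_of_mem_nhds (Iio_mem_nhds (by linarith))
      filter_upwards [self_mem_nhdsWithin, h1] with m hm hm1
      filter_upwards [ae_restrict_mem measurableSet_Ioi] with r hr
      have hm : 0 < m := hm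
      rw [Real.norm_of_nonneg
        (div_nonneg (by simpa using exp_neg_sub_one_add_nonneg (m * r)) hm.le), div_le_iff₀ hm]
      refine (exp_neg_sub_one_add_le_min hm.le hm1.le hr).trans (le_of_eq (by ring))
    · filter_upwards [ae_restrict_mem measurableSet_Ioi] with r hr
      have hr : 0 < r := hr
      refine tendsto_of_tendsto_of_tendsto_of_le_of_le' tendsto_const_nhds
        (h := fun m => m * r ^ 2)
        ((Continuous.tendsto' (by fun_prop) 0 0 (by simp)).mono_left nhdsWithin_le_nhds) ?_ ?_
      · filter_upwards [self_mem_nhdsWithin] with m (hm : 0 < m)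
        exact div_nonneg (by simpa using exp_neg_sub_one_add_nonneg (m * r)) hm.le
      · filter_upwards [self_mem_nhdsWithin] with m (hm : 0 < m)
        rw [div_le_iff₀ hm, neg_mul]
        refine (exp_neg_sub_one_add_le_sq (by positivity)).trans (le_of_eq (by ring))
  have := h1.add h2
  simp only [integral_zero, add_zero] at this
  refine this.congr' ?_
  filter_upwards [self_mem_nhdsWithin] with m (hm : 0 < m)
  rw [excess, add_div, integral_div]
  congr 1
  field_simp

lemma tendsto_psi_div (B : BranchingMechanism) :
    Tendsto (fun l => B.psi l / l) (𝓝[>] 0) (𝓝 B.α) := by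
  have := (tendsto_const_nhds (x := B.α)).add B.tendsto_excess_div
  rw [add_zero] at this
  refine this.congr' ?_
  filter_upwards [self_mem_nhdsWithin] with m (hm : 0 < m)
  rw [psi_eq]
  field_simp

lemma psi_nonneg (B : BranchingMechanism) (hα : 0 ≤ B.α) {l : ℝ} (hl : 0 ≤ l) :
    0 ≤ B.psi l := by
  rw [psi_eq]
  have := B.excess_nonneg l
  positivity

lemma exists_psi_le (B : BranchingMechanism) (hα : 0 ≤ B.α) {M : ℝ} (hM : 0 ≤ M) :
    ∃ C : ℝ, 0 < C ∧ ∀ l, 0 ≤ l → l ≤ M → B.psi l ≤ C * l := by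
  obtain ⟨C, hC, h⟩ := B.exists_excess_le hM
  refine ⟨B.α + C + 1, by positivity, fun l hl hlM => ?_⟩
  rw [psi_eq]
  nlinarith [h l hl hlM]

/-- At a zero `l > 0` of ψ each of the three nonnegative terms vanishes, which forces α = σ = 0 and
π = 0 on (0, ∞). Then ψ is identically zero, against positivity near infinity. -/
lemma psi_pos (B : BranchingMechanism) (hα : 0 ≤ B.α) (hB : B.GreyCondition) {l : ℝ}
    (hl : 0 < l) : 0 < B.psi l := by
  refine (B.psi_nonneg hα hl.le).lt_of_ne' fun h0 => ?_
  obtain ⟨c, hc, hpos, -⟩ := hB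
  rw [psi_eq] at h0
  have hex := B.excess_nonneg l
  have hαl : 0 ≤ B.α * l := by positivity
  have hα0 : B.α = 0 := by
    have : B.α * l = 0 := by linarith
    simpa [hl.ne'] using this
  have hex0 : B.excess l = 0 := by linarith
  have hint : 0 ≤ ∫ r in Ioi (0 : ℝ), (Real.exp (-l * r) - 1 + l * r) ∂B.π :=
    integral_nonneg fun r => by simpa using exp_neg_sub_one_add_nonneg (l * r)
  have hsq : 0 ≤ 1 / 2 * B.σ ^ 2 * l ^ 2 := by positivity
  rw [excess] at hex0
  have hσ : B.σ = 0 := by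
    have : 1 / 2 * B.σ ^ 2 * l ^ 2 = 0 := by linarith
    simpa [hl.ne'] using this
  have hint0 : ∫ r in Ioi (0 : ℝ), (Real.exp (-l * r) - 1 + l * r) ∂B.π = 0 := by linarith
  rw [integral_eq_zero_iff_of_nonneg
    (fun r => by simpa using exp_neg_sub_one_add_nonneg (l * r)) (B.integrableOn_exp hl.le)] at hint0
  have hbot : B.π.restrict (Ioi 0) = 0 := by
    rw [← ae_eq_bot, ← eventually_false_iff_eq_bot]
    filter_upwards [hint0, ae_restrict_mem measurableSet_Ioi] with r hr hr0
    have hr0 : 0 < r := hr0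
    have := Real.add_one_lt_exp (x := -l * r) (by simp [hl.ne', hr0.ne'])
    simp only [Pi.zero_apply] at hr
    linarith
  have := hpos c le_rfl
  simp [psi, hα0, hσ, hbot] at this

end BranchingMechanism

/-! ### The r log r condition as integrability of (ψ(l) - α l)/l² at 0 -/

/-- The measure has density `f⁻¹` with respect to the finite measure `f μ`. This supplies the
s-finiteness of π that Tonelli requires. -/
lemma MeasureTheory.sFinite_of_lintegral_ne_top {α : Type*} [MeasurableSpace α] {μ : Measure α}
    {f : α → ℝ≥0∞} (hf : Measurable f) (hpos : ∀ᵐ x ∂μ, f x ≠ 0) (htop : ∀ᵐ x ∂μ, f x ≠ ∞)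
    (h : ∫⁻ x, f x ∂μ ≠ ∞) : SFinite μ := by
  have : IsFiniteMeasure (μ.withDensity f) := isFiniteMeasure_withDensity h
  rw [← withDensity_inv_same hf hpos htop]
  infer_instance

/-- The integral `∫_0^1 (exp(-u r) - 1 + u r) / u ^ 2 du`, after the substitution
`u = exp(-τ)`. -/
def lLogLIntegral (r : ℝ) : ℝ≥0∞ :=
  ∫⁻ τ in Ioi (0 : ℝ),
    ENNReal.ofReal ((Real.exp (-(Real.exp (-τ) * r)) - 1 + Real.exp (-τ) * r) * Real.exp τ)

lemma lintegral_exp_neg_Ioi (a : ℝ) :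
    ∫⁻ τ in Ioi a, ENNReal.ofReal (Real.exp (-τ)) = ENNReal.ofReal (Real.exp (-a)) := by
  rw [← ofReal_integral_eq_lintegral_ofReal (integrableOn_exp_neg_Ioi a)
    (.of_forall fun τ => (Real.exp_pos _).le), integral_exp_neg_Ioi]

/-- The integrand is at most both `r` and `r² exp(-τ)`. For `r > 1` the bounds cross at `τ = log r`:
the first contributes `r log r` before it, the second `r` after it. -/
lemma lLogLIntegral_le {r : ℝ} (hr : 0 < r) :
    lLogLIntegral r ≤ (Ioi 1).indicator (fun r => ENNReal.ofReal (r * Real.log r)) r +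
      ENNReal.ofReal (min r (r ^ 2)) := by
  have h1 : ∀ τ, (Real.exp (-(Real.exp (-τ) * r)) - 1 + Real.exp (-τ) * r) * Real.exp τ ≤ r := by
    intro τ
    calc _ ≤ Real.exp (-τ) * r * Real.exp τ := by
          gcongr; exact exp_neg_sub_one_add_le_self (by positivity)
      _ = r := by rw [mul_right_comm, ← Real.exp_add]; simp
  have h2 : ∀ τ, (Real.exp (-(Real.exp (-τ) * r)) - 1 + Real.exp (-τ) * r) * Real.exp τ ≤
      r ^ 2 * Real.exp (-τ) := by
    intro τ
    calc _ ≤ (Real.exp (-τ) * r) ^ 2 * Real.exp τ := by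
          gcongr; exact exp_neg_sub_one_add_le_sq (by positivity)
      _ = r ^ 2 * Real.exp (-τ) * (Real.exp (-τ) * Real.exp τ) := by ring
      _ = _ := by rw [← Real.exp_add]; simp
  have h3 : ∀ a, ∫⁻ τ in Ioi a, ENNReal.ofReal
      ((Real.exp (-(Real.exp (-τ) * r)) - 1 + Real.exp (-τ) * r) * Real.exp τ) ≤
      ENNReal.ofReal (r ^ 2 * Real.exp (-a)) := by
    intro a
    calc _ ≤ ∫⁻ τ in Ioi a, ENNReal.ofReal (r ^ 2) * ENNReal.ofReal (Real.exp (-τ)) := by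
          refine lintegral_mono fun τ => ?_
          rw [← ENNReal.ofReal_mul (by positivity)]
          exact ENNReal.ofReal_le_ofReal (h2 τ)
      _ = _ := by
          rw [lintegral_const_mul' _ _ ENNReal.ofReal_ne_top, lintegral_exp_neg_Ioi,
            ENNReal.ofReal_mul (by positivity)]
  rcases le_or_gt r 1 with h | h
  · rw [indicator_of_notMem (by simpa using h), zero_add, min_eq_right (by nlinarith)]
    simpa [lLogLIntegral] using h3 0
  · rw [indicator_of_mem (by simpa using h), min_eq_left (by nlinarith), lLogLIntegral,
      ← Ioc_union_Ioi_eq_Ioi (Real.log_pos h).le]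
    refine (lintegral_union_le _ _ _).trans (add_le_add ?_ ((h3 _).trans (le_of_eq ?_)))
    · calc _ ≤ ∫⁻ τ in Ioc 0 (Real.log r), ENNReal.ofReal r :=
            lintegral_mono fun τ => ENNReal.ofReal_le_ofReal (h1 τ)
        _ = _ := by
            rw [setLIntegral_const, Real.volume_Ioc, sub_zero, ENNReal.ofReal_mul (by positivity)]
    · rw [Real.exp_neg, Real.exp_log hr]
      congr 1
      field_simp

/-- Since exp(-y) - 1 + y ≥ y/2 for y ≥ 2, the integrand is at least `r / 2` as long as `τ ≤ log r -
log 2`. The remaining `r log 2` is absorbed by the second term. -/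
lemma ofReal_mul_log_le {r : ℝ} (hr : 1 < r) :
    ENNReal.ofReal (r * Real.log r) ≤
      2 * lLogLIntegral r + ENNReal.ofReal (Real.log 2 * min r (r ^ 2)) := by
  have hlog2 : 0 < Real.log 2 := Real.log_pos (by norm_num)
  rw [min_eq_left (by nlinarith)]
  rcases le_or_gt r 2 with h | h
  · refine le_add_left (ENNReal.ofReal_le_ofReal ?_)
    have := Real.log_le_log (by positivity) h
    nlinarith
  · have hle : Real.log 2 ≤ Real.log r := Real.log_le_log (by positivity) h.le
    have key : ENNReal.ofReal (r / 2 * (Real.log r - Real.log 2)) ≤ lLogLIntegral r := by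
      calc _ = ∫⁻ τ in Ioc 0 (Real.log r - Real.log 2), ENNReal.ofReal (r / 2) := by
            rw [setLIntegral_const, Real.volume_Ioc, sub_zero, ENNReal.ofReal_mul (by positivity)]
        _ ≤ ∫⁻ τ in Ioc 0 (Real.log r - Real.log 2), ENNReal.ofReal
            ((Real.exp (-(Real.exp (-τ) * r)) - 1 + Real.exp (-τ) * r) * Real.exp τ) := by
            refine setLIntegral_mono' measurableSet_Ioc fun τ hτ => ENNReal.ofReal_le_ofReal ?_
            have h1 : 2 ≤ Real.exp (-τ) * r := by
              have : Real.exp (Real.log 2) ≤ Real.exp (-τ + Real.log r) :=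
                Real.exp_le_exp.2 (by linarith [hτ.2])
              rwa [Real.exp_add, Real.exp_log (by norm_num), Real.exp_log (by linarith)] at this
            calc r / 2 = Real.exp (-τ) * r / 2 * Real.exp τ := by
                  rw [mul_div_assoc, mul_right_comm, ← Real.exp_add]; simp
              _ ≤ _ := by
                  gcongr
                  linarith [Real.exp_pos (-(Real.exp (-τ) * r))]
        _ ≤ _ := lintegral_mono_set Ioc_subset_Ioi_self
    calc ENNReal.ofReal (r * Real.log r)
        = 2 * ENNReal.ofReal (r / 2 * (Real.log r - Real.log 2)) +
          ENNReal.ofReal (Real.log 2 * r) := by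
          rw [← ENNReal.ofReal_ofNat 2, ← ENNReal.ofReal_mul (by norm_num),
            ← ENNReal.ofReal_add (by nlinarith) (by positivity)]
          congr 1; ring
      _ ≤ _ := by gcongr

namespace BranchingMechanism

lemma sFinite_restrict (B : BranchingMechanism) : SFinite (B.π.restrict (Ioi 0)) := by
  refine sFinite_of_lintegral_ne_top (f := fun r => ENNReal.ofReal (min r (r ^ 2)))
    (by fun_prop) ?_ (.of_forall fun _ => ENNReal.ofReal_ne_top)
    ((setLIntegral_le_lintegral _ _).trans_lt B.lintegral_lt_top).ne
  filter_upwards [ae_restrict_mem measurableSet_Ioi] with r hr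
  have hr : 0 < r := hr
  simp [hr, hr.ne']

lemma lintegral_excess_exp (B : BranchingMechanism) :
    ∫⁻ τ in Ioi (0 : ℝ), ENNReal.ofReal (B.excess (Real.exp (-τ)) * Real.exp τ) =
      ENNReal.ofReal (1 / 2 * B.σ ^ 2) + ∫⁻ r in Ioi (0 : ℝ), lLogLIntegral r ∂B.π := by
  have hs := B.sFinite_restrict
  have h : ∀ τ, ENNReal.ofReal (B.excess (Real.exp (-τ)) * Real.exp τ) =
      ENNReal.ofReal (1 / 2 * B.σ ^ 2) * ENNReal.ofReal (Real.exp (-τ)) +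
      ∫⁻ r in Ioi (0 : ℝ), ENNReal.ofReal
        ((Real.exp (-(Real.exp (-τ) * r)) - 1 + Real.exp (-τ) * r) * Real.exp τ) ∂B.π := by
    intro τ
    have hnn : ∀ r : ℝ, 0 ≤ (Real.exp (-Real.exp (-τ) * r) - 1 + Real.exp (-τ) * r) *
        Real.exp τ := fun r => by
      refine mul_nonneg ?_ (Real.exp_pos _).le
      simpa using exp_neg_sub_one_add_nonneg (Real.exp (-τ) * r)
    have h1 := ofReal_integral_eq_lintegral_ofReal
      ((B.integrableOn_exp (Real.exp_pos (-τ)).le).mul_const (Real.exp τ)) (.of_forall hnn)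
    simp only [← neg_mul]
    rw [← h1, ← ENNReal.ofReal_mul (by positivity),
      ← ENNReal.ofReal_add (by positivity) (integral_nonneg hnn), integral_mul_const, excess,
      add_mul]
    congr 2
    calc _ = 1 / 2 * B.σ ^ 2 * Real.exp (-τ) * (Real.exp (-τ) * Real.exp τ) := by ring
      _ = _ := by rw [← Real.exp_add]; simp
  simp_rw [h]
  rw [lintegral_add_left (by fun_prop), lintegral_const_mul _ (by fun_prop),
    lintegral_exp_neg_Ioi, lintegral_lintegral_swap (by fun_prop)]
  simp [lLogLIntegral]

/-- The `L log L` condition, in terms of the behaviour of `ψ` at `0`. -/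
lemma lintegral_excess_exp_lt_top_iff (B : BranchingMechanism) :
    ∫⁻ τ in Ioi (0 : ℝ), ENNReal.ofReal (B.excess (Real.exp (-τ)) * Real.exp τ) < ∞ ↔
      ∫⁻ r in Ioi (1 : ℝ), ENNReal.ofReal (r * Real.log r) ∂B.π < ∞ := by
  have hmin : ∫⁻ r in Ioi 0, ENNReal.ofReal (min r (r ^ 2)) ∂B.π < ∞ :=
    (setLIntegral_le_lintegral _ _).trans_lt B.lintegral_lt_top
  rw [lintegral_excess_exp, ENNReal.add_lt_top]
  constructor
  · rintro ⟨-, h⟩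
    calc _ ≤ ∫⁻ r in Ioi (1 : ℝ), (2 * lLogLIntegral r +
            ENNReal.ofReal (Real.log 2) * ENNReal.ofReal (min r (r ^ 2))) ∂B.π := by
          refine setLIntegral_mono' measurableSet_Ioi fun r hr => ?_
          rw [← ENNReal.ofReal_mul (Real.log_pos (by norm_num)).le]
          exact ofReal_mul_log_le hr
      _ ≤ ∫⁻ r in Ioi (0 : ℝ), (2 * lLogLIntegral r +
            ENNReal.ofReal (Real.log 2) * ENNReal.ofReal (min r (r ^ 2))) ∂B.π :=
          lintegral_mono_set (Ioi_subset_Ioi zero_le_one)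
      _ = 2 * ∫⁻ r in Ioi (0 : ℝ), lLogLIntegral r ∂B.π + ENNReal.ofReal (Real.log 2) *
            ∫⁻ r in Ioi (0 : ℝ), ENNReal.ofReal (min r (r ^ 2)) ∂B.π := by
          rw [lintegral_add_right _ (by fun_prop), lintegral_const_mul' _ _ (by simp),
            lintegral_const_mul' _ _ ENNReal.ofReal_ne_top]
      _ < ∞ := ENNReal.add_lt_top.2
          ⟨ENNReal.mul_lt_top (by simp) h, ENNReal.mul_lt_top (by simp) hmin⟩
  · refine fun h => ⟨ENNReal.ofReal_lt_top, ?_⟩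
    calc _ ≤ ∫⁻ r in Ioi (0 : ℝ), ((Ioi 1).indicator (fun r => ENNReal.ofReal (r * Real.log r)) r +
            ENNReal.ofReal (min r (r ^ 2))) ∂B.π :=
          setLIntegral_mono' measurableSet_Ioi fun r hr => lLogLIntegral_le hr
      _ < ∞ := by
          rw [lintegral_add_right _ (by fun_prop)]
          refine ENNReal.add_lt_top.2 ⟨(setLIntegral_le_lintegral _ _).trans_lt ?_, hmin⟩
          rwa [lintegral_indicator measurableSet_Ioi]

end BranchingMechanism

/-! ### The Grey integral, its inverse, and the cumulant semigroup -/

namespace BranchingMechanism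

/-- The function `x ↦ ∫_x^∞ dl / ψ(l)`. -/
def greyIntegral (B : BranchingMechanism) (x : ℝ) : ℝ := ∫ l in Ioi x, 1 / B.psi l

/-- The inverse of `x ↦ ∫_x^∞ dl / ψ(l)`, that is, `t ↦ u_t(∞)`. -/
def flow (B : BranchingMechanism) (t : ℝ) : ℝ := Function.invFunOn B.greyIntegral (Ioi 0) t

variable {B : BranchingMechanism} (hα : 0 ≤ B.α) (hB : B.GreyCondition)
include hα hB

lemma continuousOn_one_div_psi : ContinuousOn (fun l => 1 / B.psi l) (Ioi 0) :=
  continuousOn_const.div (B.continuousOn_psi.mono Ioi_subset_Ici_self)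
    fun _ hl => (B.psi_pos hα hB hl).ne'

lemma integrableOn_one_div_psi {x : ℝ} (hx : 0 < x) :
    IntegrableOn (fun l => 1 / B.psi l) (Ioi x) := by
  obtain ⟨c, hc, -, hint⟩ := id hB
  refine IntegrableOn.mono_set (t := Icc x c ∪ Ioi c) ?_ fun y (hy : x < y) => ?_
  · exact (((continuousOn_one_div_psi hα hB).mono fun y hy => hx.trans_le hy.1).integrableOn_Icc).union
      hint
  · rcases le_or_gt y c with h | h
    · exact .inl ⟨hy.le, h⟩
    · exact .inr h

lemma greyIntegral_eq_sub {a x : ℝ} (ha : 0 < a) (hax : a ≤ x) :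
    B.greyIntegral x = B.greyIntegral a - ∫ l in a..x, 1 / B.psi l := by
  have := intervalIntegral.integral_Ioi_sub_Ioi (integrableOn_one_div_psi hα hB ha) hax
  rw [greyIntegral, greyIntegral, ← this]
  ring

lemma hasDerivAt_greyIntegral {x : ℝ} (hx : 0 < x) :
    HasDerivAt B.greyIntegral (-(1 / B.psi x)) x := by
  have hx2 : 0 < x / 2 := by positivity
  have hxlt : x / 2 < x := by linarith
  have hcont := (continuousOn_one_div_psi hα hB)
  have h1 : HasDerivAt (fun y => ∫ l in (x / 2)..y, 1 / B.psi l) (1 / B.psi x) x := by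
    refine intervalIntegral.integral_hasDerivAt_right ?_ ?_ (hcont.continuousAt (Ioi_mem_nhds hx))
    · refine ContinuousOn.intervalIntegrable (hcont.mono ?_)
      rw [uIcc_of_le hxlt.le]
      exact fun y hy => hx2.trans_le hy.1
    · exact hcont.stronglyMeasurableAtFilter isOpen_Ioi x hx
  refine (h1.const_sub (B.greyIntegral (x / 2))).congr_of_eventuallyEq ?_
  filter_upwards [Ioi_mem_nhds hxlt] with y hy
  exact greyIntegral_eq_sub hα hB hx2 (le_of_lt hy)

lemma strictAntiOn_greyIntegral : StrictAntiOn B.greyIntegral (Ioi 0) := by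
  refine strictAntiOn_of_deriv_neg (convex_Ioi 0)
    (fun x hx => (hasDerivAt_greyIntegral hα hB hx).continuousAt.continuousWithinAt) ?_
  rw [interior_Ioi]
  intro x hx
  rw [(hasDerivAt_greyIntegral hα hB hx).deriv, neg_lt_zero]
  exact one_div_pos.2 (B.psi_pos hα hB hx)

lemma greyIntegral_pos {x : ℝ} (hx : 0 < x) : 0 < B.greyIntegral x := by
  have h := strictAntiOn_greyIntegral hα hB hx (show x + 1 ∈ Ioi 0 by simp; linarith)
    (lt_add_one x)
  refine lt_of_le_of_lt (setIntegral_nonneg measurableSet_Ioi fun l hl => ?_) h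
  have : x + 1 < l := hl
  exact one_div_nonneg.2 (B.psi_nonneg hα (by linarith))

lemma tendsto_greyIntegral_atTop : Tendsto B.greyIntegral atTop (𝓝 0) := by
  have h := intervalIntegral_tendsto_integral_Ioi 1 (integrableOn_one_div_psi hα hB one_pos)
    tendsto_id
  have h2 := h.const_sub (B.greyIntegral 1)
  rw [← greyIntegral, sub_self] at h2
  refine h2.congr' ?_
  filter_upwards [eventually_ge_atTop 1] with x hx
  exact (greyIntegral_eq_sub hα hB one_pos hx).symm

variable {u : ℝ → ℝ → ℝ} (hu : B.IsCumulant u)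
include hu

omit hB in
lemma cumulant_le {l t : ℝ} (hl : 0 < l) (ht : 0 ≤ t) : u l t ≤ l := by
  have h : AntitoneOn (u l) (Ici 0) := by
    refine antitoneOn_of_deriv_nonpos (convex_Ici 0)
      (fun t ht => ((hu l hl).2 t ht).2.continuousWithinAt) ?_ ?_ <;> rw [interior_Ici] <;>
      intro t ht
    · exact (((hu l hl).2 t (le_of_lt ht)).2.hasDerivAt
        (Ici_mem_nhds ht)).differentiableAt.differentiableWithinAt
    · rw [(((hu l hl).2 t (le_of_lt ht)).2.hasDerivAt (Ici_mem_nhds ht)).deriv, neg_nonpos]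
      exact B.psi_nonneg hα ((hu l hl).2 t (le_of_lt ht)).1
  simpa [(hu l hl).1] using h self_mem_Ici ht ht

omit hB in
-- Grönwall: ψ(v) ≤ C v on [0, l], where the trajectory stays, so `u l t * exp (C t)` is
-- nondecreasing.
lemma cumulant_pos {l t : ℝ} (hl : 0 < l) (ht : 0 ≤ t) : 0 < u l t := by
  obtain ⟨C, hC, hle⟩ := B.exists_psi_le hα hl.le
  have hd : ∀ t, 0 ≤ t → HasDerivWithinAt (fun t => u l t * Real.exp (C * t))
      (-B.psi (u l t) * Real.exp (C * t) + u l t * (Real.exp (C * t) * C)) (Ici 0) t :=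
    fun t ht => ((hu l hl).2 t ht).2.mul
      (((hasDerivAt_id t).const_mul C).exp.hasDerivWithinAt.congr_deriv (by simp))
  have h : MonotoneOn (fun t => u l t * Real.exp (C * t)) (Ici 0) := by
    refine monotoneOn_of_deriv_nonneg (convex_Ici 0)
      (fun t ht => (hd t ht).continuousWithinAt) ?_ ?_ <;> rw [interior_Ici] <;> intro t ht
    · exact ((hd t (le_of_lt ht)).hasDerivAt
        (Ici_mem_nhds ht)).differentiableAt.differentiableWithinAt
    · rw [((hd t (le_of_lt ht)).hasDerivAt (Ici_mem_nhds ht)).deriv]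
      have h1 := hle (u l t) ((hu l hl).2 t (le_of_lt ht)).1 (cumulant_le hα hu hl (le_of_lt ht))
      have h2 : 0 ≤ (C * u l t - B.psi (u l t)) * Real.exp (C * t) :=
        mul_nonneg (by linarith) (Real.exp_pos _).le
      linarith
  have h0 := h self_mem_Ici ht ht
  simp only [(hu l hl).1, mul_zero, Real.exp_zero, mul_one] at h0
  exact pos_of_mul_pos_left (hl.trans_le h0) (Real.exp_pos _).le

/-- Along the flow, φ(u_t) has time derivative (-1/ψ(u_t)) · (-ψ(u_t)) = 1. -/
lemma greyIntegral_cumulant {l t : ℝ} (hl : 0 < l) (ht : 0 ≤ t) :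
    B.greyIntegral (u l t) = B.greyIntegral l + t := by
  have hd : ∀ t, 0 ≤ t → HasDerivWithinAt (fun t => B.greyIntegral (u l t) - t) 0 (Ici 0) t := by
    intro t ht
    have hpos := cumulant_pos hα hu hl ht
    have h1 := ((hasDerivAt_greyIntegral hα hB hpos).comp_hasDerivWithinAt t
      ((hu l hl).2 t ht).2).sub (hasDerivWithinAt_id t (Ici 0))
    refine h1.congr_deriv ?_
    have := (B.psi_pos hα hB hpos).ne'
    field_simp
    ring
  have := constant_of_has_deriv_right_zero (a := 0) (b := t)
    (fun s hs => ((hd s hs.1).continuousWithinAt).mono Icc_subset_Ici_self)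
    (fun s hs => (hd s hs.1).mono (Ici_subset_Ici.2 hs.1)) t ⟨ht, le_rfl⟩
  simp only [(hu l hl).1, sub_zero] at this
  linarith

/-- Start from `l` so large that φ(l) < s and run the cumulant for the remaining time s - φ(l). -/
lemma greyIntegral_mem_image {s : ℝ} (hs : 0 < s) : s ∈ B.greyIntegral '' Ioi 0 := by
  obtain ⟨l, hl, hl0⟩ := (((tendsto_greyIntegral_atTop hα hB).eventually (gt_mem_nhds hs)).and
    (eventually_gt_atTop 0)).exists
  refine ⟨u l (s - B.greyIntegral l), cumulant_pos hα hu hl0 (by linarith), ?_⟩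
  rw [greyIntegral_cumulant hα hB hu hl0 (by linarith)]
  ring

lemma flow_pos {s : ℝ} (hs : 0 < s) : 0 < B.flow s :=
  Function.invFunOn_mem (greyIntegral_mem_image hα hB hu hs)

lemma greyIntegral_flow {s : ℝ} (hs : 0 < s) : B.greyIntegral (B.flow s) = s :=
  Function.invFunOn_eq (greyIntegral_mem_image hα hB hu hs)

omit hu in
lemma flow_greyIntegral {x : ℝ} (hx : 0 < x) : B.flow (B.greyIntegral x) = x :=
  (strictAntiOn_greyIntegral hα hB).injOn.leftInvOn_invFunOn hx

lemma cumulant_eq_flow {l t : ℝ} (hl : 0 < l) (ht : 0 ≤ t) :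
    u l t = B.flow (t + B.greyIntegral l) := by
  rw [add_comm, ← greyIntegral_cumulant hα hB hu hl ht,
    flow_greyIntegral hα hB (cumulant_pos hα hu hl ht)]

lemma cumulant_flow {s t : ℝ} (hs : 0 < s) (ht : 0 ≤ t) :
    u (B.flow s) t = B.flow (t + s) := by
  rw [cumulant_eq_flow hα hB hu (flow_pos hα hB hu hs) ht, greyIntegral_flow hα hB hu hs]

lemma hasDerivAt_flow {s : ℝ} (hs : 0 < s) : HasDerivAt B.flow (-B.psi (B.flow s)) s := by
  -- Near `s`, `flow` is the cumulant trajectory started from `flow (s / 2)`, so it inherits the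
  -- differential equation.
  have hs2 : 0 < s / 2 := by positivity
  have hv := flow_pos hα hB hu hs2
  have h1 := ((hu _ hv).2 (s - s / 2) (by linarith)).2.hasDerivAt (Ici_mem_nhds (by linarith))
  have h2 := h1.comp_sub_const s (s / 2)
  have h3 : u (B.flow (s / 2)) (s - s / 2) = B.flow s := by
    rw [cumulant_flow hα hB hu hs2 (by linarith), sub_add_cancel]
  rw [h3] at h2
  refine h2.congr_of_eventuallyEq ?_
  filter_upwards [Ioi_mem_nhds (show s / 2 < s by linarith)] with t ht
  have : s / 2 < t := ht
  rw [cumulant_flow hα hB hu hs2 (by linarith), sub_add_cancel]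

lemma flow_lt_iff {s x : ℝ} (hs : 0 < s) (hx : 0 < x) :
    B.flow s < x ↔ B.greyIntegral x < s := by
  conv_rhs => rw [← greyIntegral_flow hα hB hu hs]
  exact ((strictAntiOn_greyIntegral hα hB).lt_iff_gt hx (flow_pos hα hB hu hs)).symm

lemma strictAntiOn_flow : StrictAntiOn B.flow (Ioi 0) := fun s hs t ht hst => by
  rw [flow_lt_iff hα hB hu ht (flow_pos hα hB hu hs), greyIntegral_flow hα hB hu hs]
  exact hst

lemma tendsto_flow_atTop : Tendsto B.flow atTop (𝓝[>] 0) := by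
  refine tendsto_nhdsWithin_iff.2 ⟨tendsto_order.2 ⟨fun a ha => ?_, fun a ha => ?_⟩, ?_⟩
  · filter_upwards [eventually_gt_atTop 0] with s hs using ha.trans (flow_pos hα hB hu hs)
  · filter_upwards [eventually_gt_atTop 0, eventually_gt_atTop (B.greyIntegral a)] with s hs hs'
    exact (flow_lt_iff hα hB hu hs ha).2 hs'
  · filter_upwards [eventually_gt_atTop 0] with s hs using flow_pos hα hB hu hs

lemma tendsto_flow_zero : Tendsto B.flow (𝓝[>] 0) atTop := by
  refine tendsto_atTop.2 fun M => ?_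
  have hM : 0 < max M 1 := by positivity
  filter_upwards [self_mem_nhdsWithin,
    mem_nhdsWithin_of_mem_nhds (Iio_mem_nhds (greyIntegral_pos hα hB hM))] with s hs hs'
  refine (le_max_left M 1).trans ?_
  by_contra! h
  exact absurd ((flow_lt_iff hα hB hu hs hM).1 h) (not_lt.2 (le_of_lt hs'))

/-! ### The limit of exp(α t) ψ(u_t(∞)) -/

omit hu in
/-- The derivative of `τ ↦ log l + α ∫_l^∞ dm / ψ(m)`, where `l = exp(-τ)`. -/
lemma hasDerivAt_log_add_greyIntegral (τ : ℝ) :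
    HasDerivAt (fun τ => -τ + B.α * B.greyIntegral (Real.exp (-τ)))
      (-(B.excess (Real.exp (-τ)) / B.psi (Real.exp (-τ)))) τ := by
  have h1 := (hasDerivAt_greyIntegral hα hB (Real.exp_pos (-τ))).comp τ (hasDerivAt_neg τ).exp
  refine ((hasDerivAt_neg τ).add (h1.const_mul B.α)).congr_deriv ?_
  have h2 := (B.psi_pos hα hB (Real.exp_pos (-τ))).ne'
  have h3 := B.psi_eq (Real.exp (-τ))
  field_simp
  rw [h3]
  ring

omit hu in
lemma tendsto_log_add_greyIntegral (hα' : 0 < B.α) :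
    (B.LLogLCondition → ∃ a, Tendsto (fun τ => -τ + B.α * B.greyIntegral (Real.exp (-τ)))
      atTop (𝓝 a)) ∧
    (¬ B.LLogLCondition → Tendsto (fun τ => -τ + B.α * B.greyIntegral (Real.exp (-τ)))
      atTop atBot) := by
  have hd := hasDerivAt_log_add_greyIntegral hα hB
  have hnn : ∀ τ, 0 ≤ B.excess (Real.exp (-τ)) / B.psi (Real.exp (-τ)) := fun τ =>
    div_nonneg (B.excess_nonneg _) (B.psi_nonneg hα (Real.exp_pos _).le)
  have hcexp : Continuous fun τ : ℝ => Real.exp (-τ) := by fun_prop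
  have hce : Continuous fun τ => B.excess (Real.exp (-τ)) :=
    B.continuousOn_excess.comp_continuous hcexp fun τ => (Real.exp_pos _).le
  have hcp : Continuous fun τ => B.psi (Real.exp (-τ)) :=
    B.continuousOn_psi.comp_continuous hcexp fun τ => (Real.exp_pos _).le
  have hcq : Continuous fun τ => B.excess (Real.exp (-τ)) / B.psi (Real.exp (-τ)) :=
    hce.div hcp fun τ => (B.psi_pos hα hB (Real.exp_pos _)).ne'
  have hmul : ∀ τ : ℝ, Real.exp (-τ) * Real.exp τ = 1 := fun τ => by
    rw [← Real.exp_add]; simp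
  constructor
  · rintro ⟨-, hL⟩
    rw [← lintegral_excess_exp_lt_top_iff] at hL
    have hint : IntegrableOn (fun τ => B.excess (Real.exp (-τ)) * Real.exp τ) (Ioi 0) := by
      refine ⟨(hce.mul Real.continuous_exp).aestronglyMeasurable, ?_⟩
      rw [hasFiniteIntegral_iff_ofReal]
      · exact hL
      · exact .of_forall fun τ => mul_nonneg (B.excess_nonneg _) (Real.exp_pos _).le
    -- Domination uses ψ(l) ≥ α l with l = exp(-τ).
    have hint2 : IntegrableOn (fun τ => -(B.excess (Real.exp (-τ)) / B.psi (Real.exp (-τ))))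
        (Ioi 0) := by
      refine Integrable.mono' (hint.const_mul B.α⁻¹) hcq.neg.aestronglyMeasurable
        (.of_forall fun τ => ?_)
      rw [norm_neg, Real.norm_of_nonneg (hnn τ), div_le_iff₀ (B.psi_pos hα hB (Real.exp_pos _))]
      have h1 := B.excess_nonneg (Real.exp (-τ))
      calc B.excess (Real.exp (-τ))
          = B.α⁻¹ * (B.excess (Real.exp (-τ)) * Real.exp τ) * (B.α * Real.exp (-τ)) := by
            have := hmul τ
            field_simp
            rw [mul_assoc, mul_comm (Real.exp τ), this, mul_one]
        _ ≤ _ := by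
            gcongr
            rw [psi_eq]
            linarith
    exact ⟨_, tendsto_limUnder_of_hasDerivAt_of_integrableOn_Ioi (fun τ _ => hd τ) hint2⟩
  · intro hL
    have hanti : Antitone fun τ => -τ + B.α * B.greyIntegral (Real.exp (-τ)) := by
      refine antitone_of_deriv_nonpos (fun τ => (hd τ).differentiableAt) fun τ => ?_
      rw [(hd τ).deriv, neg_nonpos]
      exact hnn τ
    refine (tendsto_atTop_of_antitone hanti).resolve_right ?_
    rintro ⟨a, ha⟩
    refine hL ⟨hα', ?_⟩
    -- A finite limit makes the one-signed derivative integrable; ψ(l) ≤ C l on [0, 1] then bounds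
    -- excess(l)/l by C · excess(l)/ψ(l).
    have hint := integrableOn_Ioi_deriv_of_nonpos (a := 0) (hd 0).continuousAt.continuousWithinAt
      (fun τ _ => hd τ) (fun τ _ => neg_nonpos.2 (hnn τ)) ha
    obtain ⟨C, hC, hle⟩ := B.exists_psi_le hα zero_le_one
    rw [← lintegral_excess_exp_lt_top_iff]
    have hfin := (hint.neg.const_mul C).2
    rw [hasFiniteIntegral_iff_ofReal
      (.of_forall fun τ => by simpa using mul_nonneg hC.le (hnn τ))] at hfin
    refine (setLIntegral_mono' measurableSet_Ioi fun τ (hτ : 0 < τ) => ?_).trans_lt hfin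
    refine ENNReal.ofReal_le_ofReal ?_
    simp only [Pi.neg_apply, neg_neg]
    rw [← mul_div_assoc, le_div_iff₀ (B.psi_pos hα hB (Real.exp_pos _))]
    have h1 := hle (Real.exp (-τ)) (Real.exp_pos _).le (by simpa using hτ.le)
    have h2 := B.excess_nonneg (Real.exp (-τ))
    calc _ ≤ B.excess (Real.exp (-τ)) * Real.exp τ * (C * Real.exp (-τ)) := by gcongr
      _ = C * B.excess (Real.exp (-τ)) * (Real.exp (-τ) * Real.exp τ) := by ring
      _ = _ := by rw [hmul, mul_one]

/-- Evaluates the function of `hasDerivAt_log_add_greyIntegral` at τ = -log v(t), where φ(exp(-τ)) =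
t. -/
lemma exp_mul_flow_eq {t : ℝ} (ht : 0 < t) :
    Real.exp (B.α * t) * B.flow t = Real.exp (- -Real.log (B.flow t) + B.α *
      B.greyIntegral (Real.exp (- -Real.log (B.flow t)))) := by
  have hv := flow_pos hα hB hu ht
  rw [neg_neg, Real.exp_log hv, greyIntegral_flow hα hB hu ht, Real.exp_add, Real.exp_log hv,
    mul_comm]

lemma tendsto_neg_log_flow : Tendsto (fun t => -Real.log (B.flow t)) atTop atTop :=
  tendsto_neg_atBot_atTop.comp
    (Real.tendsto_log_nhdsGT_zero.comp (tendsto_flow_atTop hα hB hu))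

lemma exists_tendsto_exp_mul_psi_flow (hL : B.LLogLCondition) :
    ∃ w, 0 < w ∧ Tendsto (fun t => Real.exp (B.α * t) * B.psi (B.flow t)) atTop (𝓝 w) := by
  obtain ⟨a, ha⟩ := (tendsto_log_add_greyIntegral hα hB hL.1).1 hL
  refine ⟨Real.exp a * B.α, mul_pos (Real.exp_pos _) hL.1, ?_⟩
  have h1 := (Real.continuous_exp.tendsto a).comp (ha.comp (tendsto_neg_log_flow hα hB hu))
  refine (h1.mul (B.tendsto_psi_div.comp (tendsto_flow_atTop hα hB hu))).congr' ?_
  filter_upwards [eventually_gt_atTop 0] with t ht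
  have hv := flow_pos hα hB hu ht
  simp only [Function.comp_apply]
  rw [← exp_mul_flow_eq hα hB hu ht]
  field_simp

lemma tendsto_exp_mul_psi_flow_zero (hL : ¬ B.LLogLCondition) :
    Tendsto (fun t => Real.exp (B.α * t) * B.psi (B.flow t)) atTop (𝓝 0) := by
  rcases hα.eq_or_lt with h0 | hα'
  · simp only [← h0, zero_mul, Real.exp_zero, one_mul]
    have h1 := (B.continuousOn_psi 0 self_mem_Ici).tendsto.mono_left
      (nhdsWithin_mono _ Ioi_subset_Ici_self)
    rw [psi_zero] at h1
    exact h1.comp (tendsto_flow_atTop hα hB hu)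
  · have h1 := Real.tendsto_exp_atBot.comp (((tendsto_log_add_greyIntegral hα hB hα').2 hL).comp
      (tendsto_neg_log_flow hα hB hu))
    have h2 := h1.mul (B.tendsto_psi_div.comp (tendsto_flow_atTop hα hB hu))
    rw [zero_mul] at h2
    refine h2.congr' ?_
    filter_upwards [eventually_gt_atTop 0] with t ht
    have hv := flow_pos hα hB hu ht
    simp only [Function.comp_apply]
    rw [← exp_mul_flow_eq hα hB hu ht]
    field_simp

end BranchingMechanism

/-! ### The continuity theorem for Laplace transforms -/

open BoundedContinuousFunction in
/-- The function `y ↦ exp (-y)` on `[0, ∞)`. -/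
def expNegBCF : ℝ≥0 →ᵇ ℝ :=
  .ofNormedAddCommGroup (fun y : ℝ≥0 => Real.exp (-(y : ℝ))) (by fun_prop) 1 fun y => by
    rw [Real.norm_of_nonneg (Real.exp_pos _).le, Real.exp_le_one_iff]
    simp

@[simp] lemma expNegBCF_apply (y : ℝ≥0) : expNegBCF y = Real.exp (-(y : ℝ)) := rfl

/-- The algebra of polynomials in `y ↦ exp (-y)`. -/
def expNegAlgebra : StarSubalgebra ℝ (BoundedContinuousFunction ℝ≥0 ℝ) where
  toSubalgebra := (Polynomial.aeval (R := ℝ) expNegBCF).range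
  star_mem' := fun {a} ha => by rwa [show star a = a from BoundedContinuousFunction.ext fun _ => rfl]

lemma separatesPoints_expNegAlgebra :
    (expNegAlgebra.map
      (BoundedContinuousFunction.toContinuousMapStarₐ ℝ)).SeparatesPoints := by
  intro x y hxy
  refine ⟨fun y => expNegBCF y, ⟨BoundedContinuousFunction.toContinuousMapStarₐ ℝ expNegBCF,
    ⟨expNegBCF, ⟨Polynomial.X, by simp⟩, rfl⟩, rfl⟩, ?_⟩
  simpa using hxy

lemma integrable_exp_neg_mul_nnreal (μ : Measure ℝ≥0) [IsFiniteMeasure μ] {l : ℝ} (hl : 0 ≤ l) :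
    Integrable (fun y : ℝ≥0 => Real.exp (-l * y)) μ := by
  refine Integrable.mono' (integrable_const 1) (by fun_prop) (.of_forall fun y => ?_)
  rw [Real.norm_of_nonneg (Real.exp_pos _).le, Real.exp_le_one_iff]
  have : 0 ≤ l * y := by positivity
  linarith

/-- Markov's inequality for 1 - exp(-l y), which exceeds 1 - exp(-1) when l y > 1. -/
lemma measureReal_Ioi_le_laplace (μ : Measure ℝ≥0) [IsProbabilityMeasure μ] {l : ℝ} (hl : 0 < l) :
    μ.real {y : ℝ≥0 | 1 < l * y} * (1 - Real.exp (-1)) ≤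
      1 - ∫ y : ℝ≥0, Real.exp (-l * y) ∂μ := by
  have hm : MeasurableSet {y : ℝ≥0 | 1 < l * y} := measurableSet_lt (by fun_prop) (by fun_prop)
  have h1 : ∫ y : ℝ≥0, (1 - Real.exp (-l * y)) ∂μ = 1 - ∫ y : ℝ≥0, Real.exp (-l * y) ∂μ := by
    rw [integral_sub (integrable_const 1) (integrable_exp_neg_mul_nnreal μ hl.le)]
    simp
  rw [← h1, ← smul_eq_mul, ← integral_indicator_const _ hm]
  refine integral_mono ((integrable_const _).indicator hm)
    ((integrable_const 1).sub (integrable_exp_neg_mul_nnreal μ hl.le)) fun y => ?_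
  by_cases hy : 1 < l * y
  · rw [indicator_of_mem (by exact hy)]
    have : Real.exp (-l * y) ≤ Real.exp (-1) := Real.exp_le_exp.2 (by linarith)
    simp only
    linarith
  · rw [indicator_of_notMem (by exact hy)]
    have : 0 ≤ l * y := by positivity
    simp only [sub_nonneg, Real.exp_le_one_iff]
    linarith

/-- Tightness from the convergence of Laplace transforms to a function that is continuous
at `0`. -/
lemma isTightMeasureSet_of_tendsto_laplace {μ : ℕ → ProbabilityMeasure ℝ≥0} {L : ℝ → ℝ}
    (h : ∀ l, 0 < l → Tendsto (fun n => ∫ y : ℝ≥0, Real.exp (-l * y) ∂(μ n : Measure ℝ≥0))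
      atTop (𝓝 (L l)))
    (hL : Tendsto L (𝓝[>] 0) (𝓝 1)) :
    IsTightMeasureSet {(μ n : Measure ℝ≥0) | n} := by
  rw [isTightMeasureSet_iff_exists_isCompact_measure_compl_le]
  intro ε hε
  rcases eq_or_ne ε ∞ with rfl | hεtop
  · exact ⟨∅, isCompact_empty, fun _ _ => le_top⟩
  lift ε to ℝ≥0 using hεtop
  have hε : 0 < ε := by simpa using hε
  have he : 0 < 1 - Real.exp (-1) := by simp
  have hδ : 0 < ε * (1 - Real.exp (-1)) := mul_pos (by exact_mod_cast hε) he
  obtain ⟨l, hl1, hl⟩ : ∃ l, 1 - ε * (1 - Real.exp (-1)) < L l ∧ 0 < l :=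
    ((hL.eventually (lt_mem_nhds (by linarith))).and self_mem_nhdsWithin).exists
  obtain ⟨N, hN⟩ := eventually_atTop.1 ((h l hl).eventually (lt_mem_nhds hl1))
  have hK : ∀ n, ∃ K : Set ℝ≥0, IsCompact K ∧ (μ n : Measure ℝ≥0) Kᶜ ≤ ε := by
    intro n
    obtain ⟨K, hK, hK'⟩ := isTightMeasureSet_iff_exists_isCompact_measure_compl_le.1
      (isTightMeasureSet_singleton (μ := (μ n : Measure ℝ≥0))) ε (by simpa using hε)
    exact ⟨K, hK, hK' _ rfl⟩
  choose K hKc hK using hK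
  -- The interval serves all n ≥ N through the Laplace bound; each of the finitely many earlier laws
  -- is tight by itself.
  refine ⟨Icc 0 (Real.toNNReal l⁻¹) ∪ ⋃ n ∈ Iio N, K n,
    isCompact_Icc.union ((finite_Iio N).isCompact_biUnion fun n _ => hKc n), ?_⟩
  rintro _ ⟨n, rfl⟩
  rcases lt_or_ge n N with hn | hn
  · refine (measure_mono (compl_subset_compl.2 ?_)).trans (hK n)
    exact (subset_biUnion_of_mem (u := K) (show n ∈ Iio N from hn)).trans subset_union_right
  · have h1 := measureReal_Ioi_le_laplace (μ n : Measure ℝ≥0) hl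
    have h2 := hN n hn
    have h3 : (μ n : Measure ℝ≥0).real {y : ℝ≥0 | 1 < l * y} ≤ ε := by
      by_contra! h4
      have := mul_lt_mul_of_pos_right h4 he
      linarith
    refine le_trans (measure_mono ?_) ((ENNReal.le_ofReal_iff_toReal_le (measure_ne_top _ _)
      ε.2).2 h3 |>.trans (by simp))
    intro y hy
    simp only [compl_union, mem_inter_iff, mem_compl_iff, mem_Icc, zero_le, true_and,
      not_le] at hy
    have := (Real.toNNReal_lt_iff_lt_coe (by positivity)).1 hy.1
    rw [mem_ofPred_eq, mul_comm]
    rwa [inv_lt_iff_one_lt_mul₀ hl] at this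

lemma tendsto_integral_expNegAlgebra {ι : Type*} {F : Filter ι} {μ : ι → ProbabilityMeasure ℝ≥0}
    {ν : ProbabilityMeasure ℝ≥0}
    (h : ∀ l, 0 < l → Tendsto (fun n => ∫ y : ℝ≥0, Real.exp (-l * y) ∂(μ n : Measure ℝ≥0))
      F (𝓝 (∫ y : ℝ≥0, Real.exp (-l * y) ∂(ν : Measure ℝ≥0))))
    {g : BoundedContinuousFunction ℝ≥0 ℝ} (hg : g ∈ expNegAlgebra) :
    Tendsto (fun n => ∫ y, g y ∂(μ n : Measure ℝ≥0)) F (𝓝 (∫ y, g y ∂(ν : Measure ℝ≥0))) := by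
  obtain ⟨p, rfl⟩ := hg
  induction p using Polynomial.induction_on' with
  | add p q hp hq =>
    have key : ∀ m : ProbabilityMeasure ℝ≥0,
        ∫ y, (Polynomial.aeval (R := ℝ) expNegBCF (p + q)) y ∂(m : Measure ℝ≥0) =
        ∫ y, (Polynomial.aeval (R := ℝ) expNegBCF p) y ∂(m : Measure ℝ≥0) +
        ∫ y, (Polynomial.aeval (R := ℝ) expNegBCF q) y ∂(m : Measure ℝ≥0) := fun m => by
      rw [map_add, ← integral_add (BoundedContinuousFunction.integrable _ _)
        (BoundedContinuousFunction.integrable _ _)]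
      rfl
    simpa only [AlgHom.toRingHom_eq_coe, RingHom.coe_coe, key] using! hp.add hq
  | monomial k a =>
    have key : ∀ m : ProbabilityMeasure ℝ≥0,
        ∫ y, (Polynomial.aeval (R := ℝ) expNegBCF (Polynomial.monomial k a)) y
          ∂(m : Measure ℝ≥0) = a * ∫ y : ℝ≥0, Real.exp (-k * y) ∂(m : Measure ℝ≥0) := fun m => by
      rw [← integral_const_mul, Polynomial.aeval_monomial]
      congr 1
      ext y
      simp [Algebra.algebraMap_eq_smul_one, ← Real.exp_nat_mul]
    have key2 : Tendsto (fun n => ∫ y : ℝ≥0, Real.exp (-k * y) ∂(μ n : Measure ℝ≥0))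
      F (𝓝 (∫ y : ℝ≥0, Real.exp (-k * y) ∂(ν : Measure ℝ≥0))) := by
      rcases Nat.eq_zero_or_pos k with rfl | hk
      · simpa using tendsto_const_nhds
      · exact h k (by exact_mod_cast hk)
    simpa only [AlgHom.toRingHom_eq_coe, RingHom.coe_coe, key] using! key2.const_mul a

lemma tendsto_laplace_of_tendsto {ι : Type*} {F : Filter ι} {μ : ι → ProbabilityMeasure ℝ≥0}
    {ν : ProbabilityMeasure ℝ≥0} (h : Tendsto μ F (𝓝 ν)) {l : ℝ} (hl : 0 ≤ l) :
    Tendsto (fun n => ∫ y : ℝ≥0, Real.exp (-l * y) ∂(μ n : Measure ℝ≥0))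
      F (𝓝 (∫ y : ℝ≥0, Real.exp (-l * y) ∂(ν : Measure ℝ≥0))) := by
  refine (ProbabilityMeasure.tendsto_iff_forall_integral_tendsto.1 h)
    (.ofNormedAddCommGroup (fun y : ℝ≥0 => Real.exp (-l * y)) (by fun_prop) 1 fun y => ?_)
  rw [Real.norm_of_nonneg (Real.exp_pos _).le, Real.exp_le_one_iff]
  have : 0 ≤ l * y := by positivity
  linarith

lemma tendsto_laplace_zero (ν : ProbabilityMeasure ℝ≥0) :
    Tendsto (fun l => ∫ y : ℝ≥0, Real.exp (-l * y) ∂(ν : Measure ℝ≥0)) (𝓝[>] 0) (𝓝 1) := by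
  have : (1 : ℝ) = ∫ y : ℝ≥0, (1 : ℝ) ∂(ν : Measure ℝ≥0) := by simp
  rw [this]
  refine tendsto_integral_filter_of_dominated_convergence (fun _ => 1)
    (.of_forall fun _ => by fun_prop) ?_ (integrable_const _) (.of_forall fun y => ?_)
  · filter_upwards [self_mem_nhdsWithin] with l (hl : 0 < l)
    refine .of_forall fun y => ?_
    rw [Real.norm_of_nonneg (Real.exp_pos _).le, Real.exp_le_one_iff]
    have : 0 ≤ l * y := by positivity
    linarith
  · exact (Continuous.tendsto' (by fun_prop) 0 1 (by simp)).mono_left nhdsWithin_le_nhds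

/-- Convergence of Laplace transforms implies weak convergence. -/
lemma tendsto_of_tendsto_laplace {ι : Type*} {F : Filter ι} [F.IsCountablyGenerated]
    {μ : ι → ProbabilityMeasure ℝ≥0} {ν : ProbabilityMeasure ℝ≥0}
    (h : ∀ l, 0 < l → Tendsto (fun n => ∫ y : ℝ≥0, Real.exp (-l * y) ∂(μ n : Measure ℝ≥0))
      F (𝓝 (∫ y : ℝ≥0, Real.exp (-l * y) ∂(ν : Measure ℝ≥0)))) :
    Tendsto μ F (𝓝 ν) := by
  refine tendsto_of_seq_tendsto fun w hw => ?_
  have h' := fun l (hl : 0 < l) => (h l hl).comp hw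
  exact ProbabilityMeasure.tendsto_of_tight_of_separatesPoints ℝ
    (isTightMeasureSet_of_tendsto_laplace h' (tendsto_laplace_zero ν))
    separatesPoints_expNegAlgebra fun g hg => tendsto_integral_expNegAlgebra h' hg

/-- The continuity theorem for Laplace transforms on `[0, ∞)`. -/
lemma exists_tendsto_of_tendsto_laplace {ι : Type*} {F : Filter ι} [F.NeBot]
    [F.IsCountablyGenerated] {μ : ι → ProbabilityMeasure ℝ≥0} {L : ℝ → ℝ}
    (h : ∀ l, 0 < l → Tendsto (fun n => ∫ y : ℝ≥0, Real.exp (-l * y) ∂(μ n : Measure ℝ≥0))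
      F (𝓝 (L l)))
    (hL : Tendsto L (𝓝[>] 0) (𝓝 1)) :
    ∃ ν : ProbabilityMeasure ℝ≥0, Tendsto μ F (𝓝 ν) ∧
      ∀ l, 0 < l → ∫ y : ℝ≥0, Real.exp (-l * y) ∂(ν : Measure ℝ≥0) = L l := by
  obtain ⟨w, hw⟩ := F.exists_seq_tendsto
  have h' := fun l (hl : 0 < l) => (h l hl).comp hw
  have htight := isTightMeasureSet_of_tendsto_laplace h' hL
  have hc : IsCompact (closure {μ (w n) | n}) :=
    isCompact_closure_of_isTightMeasureSet (by simpa using htight)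
  -- An ultrafilter limit identifies a candidate with Laplace transform `L`; convergence along all
  -- of `F` then follows from uniqueness of the target transform.
  let U : Ultrafilter ℕ := Ultrafilter.of atTop
  have hU : (U : Filter ℕ) ≤ atTop := Ultrafilter.of_le atTop
  obtain ⟨ν, -, hν⟩ := hc.ultrafilter_le_nhds (U.map (μ ∘ w))
    (.trans (by simp) (monotone_principal subset_closure))
  have hlap : ∀ l, 0 < l → ∫ y : ℝ≥0, Real.exp (-l * y) ∂(ν : Measure ℝ≥0) = L l :=
    fun l hl => tendsto_nhds_unique
      (tendsto_laplace_of_tendsto (F := (U : Filter ℕ)) (μ := μ ∘ w) hν hl.le)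
      ((h' l hl).mono_left hU)
  refine ⟨ν, tendsto_of_tendsto_laplace fun l hl => ?_, hlap⟩
  rw [hlap l hl]
  exact h l hl

lemma mul_exp_neg_mul_le {l y : ℝ} (hl : 0 < l) : y * Real.exp (-l * y) ≤ l⁻¹ := by
  rw [neg_mul, Real.exp_neg, ← div_eq_mul_inv, div_le_iff₀ (Real.exp_pos _), inv_mul_eq_div,
    le_div_iff₀ hl]
  linarith [Real.add_one_le_exp (l * y)]

/-! ### Derivatives of Laplace transforms and biased laws -/

section Laplace

variable {Ω : Type*} [MeasurableSpace Ω] {μ : Measure Ω} [IsFiniteMeasure μ] {X : Ω → ℝ≥0}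

lemma integrable_exp_neg_mul (hX : Measurable X) {l : ℝ} (hl : 0 ≤ l) :
    Integrable (fun ω => Real.exp (-l * X ω)) μ := by
  refine Integrable.mono' (integrable_const 1) (by fun_prop) (.of_forall fun ω => ?_)
  rw [Real.norm_of_nonneg (Real.exp_pos _).le, Real.exp_le_one_iff]
  have : 0 ≤ l * X ω := by positivity
  linarith

lemma integrable_mul_exp_neg_mul (hX : Measurable X) {l : ℝ} (hl : 0 < l) :
    Integrable (fun ω => X ω * Real.exp (-l * X ω)) μ := by
  refine Integrable.mono' (integrable_const l⁻¹) (by fun_prop) (.of_forall fun ω => ?_)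
  rw [Real.norm_of_nonneg (by positivity)]
  exact mul_exp_neg_mul_le hl

lemma hasDerivAt_integral_exp_neg_mul (hX : Measurable X) {l : ℝ} (hl : 0 < l) :
    HasDerivAt (fun l => ∫ ω, Real.exp (-l * X ω) ∂μ)
      (-∫ ω, X ω * Real.exp (-l * X ω) ∂μ) l := by
  -- The Laplace transform is the moment generating function at -l, finite on the open half-line of
  -- negative arguments.
  have h : -l ∈ interior (integrableExpSet (fun ω => (X ω : ℝ)) μ) := by
    refine mem_interior.2 ⟨Iio 0, fun m (hm : m < 0) => ?_, isOpen_Iio, neg_lt_zero.2 hl⟩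
    simpa [integrableExpSet] using! integrable_exp_neg_mul (μ := μ) hX (neg_pos.2 hm).le
  have h2 := (hasDerivAt_mgf h).comp l (hasDerivAt_neg l)
  rw [mul_neg, mul_one] at h2
  exact h2

/-- The law of `X` under `μ`, biased by the function `y ↦ y exp (-l y)`. -/
lemma exists_biased_law (hX : Measurable X) {l : ℝ} (hl : 0 < l)
    (hpos : 0 < ∫ ω, X ω * Real.exp (-l * X ω) ∂μ) :
    ∃ ν : ProbabilityMeasure ℝ≥0,
      (∀ A, MeasurableSet A → (ν : Measure ℝ≥0) A =
        ENNReal.ofReal ((∫ ω in X ⁻¹' A, X ω * Real.exp (-l * X ω) ∂μ) /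
          ∫ ω, X ω * Real.exp (-l * X ω) ∂μ)) ∧
      ∀ m, 0 ≤ m → ∫ y : ℝ≥0, Real.exp (-m * y) ∂(ν : Measure ℝ≥0) =
        (∫ ω, X ω * Real.exp (-(l + m) * X ω) ∂μ) / ∫ ω, X ω * Real.exp (-l * X ω) ∂μ := by
  set c := ∫ ω, X ω * Real.exp (-l * X ω) ∂μ with hc
  let f : Ω → ℝ≥0∞ := fun ω => ENNReal.ofReal (X ω * Real.exp (-l * X ω) / c)
  have hf : Measurable f := by fun_prop
  have hA : ∀ A, MeasurableSet A → ((μ.withDensity f).map X) A =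
      ENNReal.ofReal ((∫ ω in X ⁻¹' A, X ω * Real.exp (-l * X ω) ∂μ) / c) := by
    intro A hA
    rw [Measure.map_apply hX hA, withDensity_apply _ (hX hA), ← integral_div,
      ofReal_integral_eq_lintegral_ofReal
      ((integrable_mul_exp_neg_mul hX hl).div_const c).integrableOn
      (.of_forall fun ω => by positivity)]
  have hp : IsProbabilityMeasure ((μ.withDensity f).map X) := by
    refine ⟨?_⟩
    rw [hA _ MeasurableSet.univ, preimage_univ, Measure.restrict_univ, ← hc,
      div_self hpos.ne', ENNReal.ofReal_one]
  refine ⟨⟨_, hp⟩, hA, fun m hm => ?_⟩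
  simp only [ProbabilityMeasure.coe_mk]
  rw [integral_map hX.aemeasurable (by fun_prop), integral_withDensity_eq_integral_toReal_smul hf
    (.of_forall fun _ => ENNReal.ofReal_lt_top), ← integral_div]
  congr 1
  ext ω
  rw [ENNReal.toReal_ofReal (by positivity), smul_eq_mul, neg_add, add_mul, Real.exp_add]
  ring

end Laplace

/-! ### The extinction time and conditioning on it -/

namespace IsCBProcess

open BranchingMechanism

variable {B : BranchingMechanism} {Ω : Type*} [MeasurableSpace Ω] {Z : ℝ≥0 → Ω → ℝ≥0}
  {P : Kernel ℝ≥0 Ω} (hα : 0 ≤ B.α) (hB : B.GreyCondition) (hZ : IsCBProcess B Z P)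
include hZ

lemma exists_isCumulant : ∃ u, B.IsCumulant u := hZ.laplace.imp fun _ h => h.1

include hα hB

lemma laplace_flow (x t : ℝ≥0) {s : ℝ} (hs : 0 < s) :
    ∫ ω, Real.exp (-B.flow s * Z t ω) ∂P x = Real.exp (-(x * B.flow (t + s))) := by
  obtain ⟨u, hu, h⟩ := hZ.laplace
  rw [h x t _ (flow_pos hα hB hu hs), cumulant_flow hα hB hu hs t.coe_nonneg]

lemma hasDerivAt_integral_exp_flow {μ : Measure Ω} [IsFiniteMeasure μ] (t : ℝ≥0) {s : ℝ}
    (hs : 0 < s) :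
    HasDerivAt (fun s => ∫ ω, Real.exp (-B.flow s * Z t ω) ∂μ)
      (B.psi (B.flow s) * ∫ ω, Z t ω * Real.exp (-B.flow s * Z t ω) ∂μ) s := by
  obtain ⟨u, hu⟩ := hZ.exists_isCumulant
  have h := (hasDerivAt_integral_exp_neg_mul (μ := μ) (hZ.measurable t)
    (flow_pos hα hB hu hs)).comp s (hasDerivAt_flow hα hB hu hs)
  refine h.congr_deriv ?_
  ring

/-- Differentiate both sides of `laplace_flow` in `s`: the flow equation produces the factors
ψ(v(s)) and ψ(v(t + s)). -/
lemma integral_mul_exp_flow (x t : ℝ≥0) {s : ℝ} (hs : 0 < s) :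
    ∫ ω, Z t ω * Real.exp (-B.flow s * Z t ω) ∂P x =
      x * (B.psi (B.flow (t + s)) / B.psi (B.flow s)) * Real.exp (-(x * B.flow (t + s))) := by
  obtain ⟨u, hu⟩ := hZ.exists_isCumulant
  have := hZ.isMarkovKernel
  have h1 := hZ.hasDerivAt_integral_exp_flow hα hB (μ := P x) t hs
  have hts : 0 < t + s := add_pos_of_nonneg_of_pos t.coe_nonneg hs
  have h2 := (((hasDerivAt_flow hα hB hu hts).comp_const_add (t : ℝ) s).const_mul (x : ℝ)).neg.exp
  have h3 : B.psi (B.flow s) * ∫ ω, Z t ω * Real.exp (-B.flow s * Z t ω) ∂P x =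
      Real.exp (-(x * B.flow (t + s))) * -(x * -B.psi (B.flow (t + s))) :=
    h1.unique (h2.congr_of_eventuallyEq ?_)
  · have hψ := (B.psi_pos hα hB (flow_pos hα hB hu hs)).ne'
    rw [← mul_right_inj' hψ, h3]
    field_simp
  · filter_upwards [Ioi_mem_nhds hs] with r hr
    exact hZ.laplace_flow hα hB x t hr

/-- As s ↓ 0, v(s) → ∞ and exp(-v(s) Z_t) tends to the indicator of Z_t = 0. -/
lemma measure_eq_zero (x : ℝ≥0) {t : ℝ≥0} (ht : 0 < t) :
    P x {ω | Z t ω = 0} = ENNReal.ofReal (Real.exp (-(x * B.flow t))) := by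
  obtain ⟨u, hu⟩ := hZ.exists_isCumulant
  have := hZ.isMarkovKernel
  have ht' : (0 : ℝ) < t := ht
  have hm : MeasurableSet {ω | Z t ω = 0} := hZ.measurable t (measurableSet_singleton 0)
  rw [← ENNReal.ofReal_toReal (measure_ne_top (P x) {ω | Z t ω = 0})]
  congr 1
  have h1 : Tendsto (fun s => ∫ ω, Real.exp (-B.flow s * Z t ω) ∂P x) (𝓝[>] 0)
      (𝓝 (∫ ω, {ω | Z t ω = 0}.indicator (1 : Ω → ℝ) ω ∂P x)) := by
    have hmt := hZ.measurable t
    refine tendsto_integral_filter_of_dominated_convergence (fun _ => 1)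
      (.of_forall fun _ => by fun_prop) ?_ (integrable_const _) (.of_forall fun ω => ?_)
    · filter_upwards [self_mem_nhdsWithin] with s hs
      refine .of_forall fun ω => ?_
      rw [Real.norm_of_nonneg (Real.exp_pos _).le, Real.exp_le_one_iff]
      have : 0 ≤ B.flow s * Z t ω := mul_nonneg (flow_pos hα hB hu hs).le (Z t ω).coe_nonneg
      linarith
    · by_cases h : Z t ω = 0
      · rw [indicator_of_mem (by exact h), h]
        simp
      · rw [indicator_of_notMem (by exact h)]
        have hpos : (0 : ℝ) < Z t ω := by exact_mod_cast pos_iff_ne_zero.2 h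
        refine Real.tendsto_exp_atBot.comp ?_
        simp only [neg_mul]
        exact tendsto_neg_atTop_atBot.comp
          ((tendsto_flow_zero hα hB hu).atTop_mul_const hpos)
  rw [integral_indicator_one hm] at h1
  have h2 : Tendsto (fun s => Real.exp (-(x * B.flow (t + s)))) (𝓝[>] 0)
      (𝓝 (Real.exp (-(x * B.flow t)))) := by
    have hc : ContinuousAt (fun s => Real.exp (-(x * B.flow (t + s)))) 0 := by
      have : ContinuousAt B.flow (t + 0) := by
        rw [add_zero]; exact (hasDerivAt_flow hα hB hu ht').continuousAt
      have : ContinuousAt (fun s => B.flow (t + s)) 0 :=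
        ContinuousAt.comp' (f := fun s => (t : ℝ) + s) this (by fun_prop)
      fun_prop
    have := hc.tendsto
    rw [add_zero] at this
    exact this.mono_left nhdsWithin_le_nhds
  refine tendsto_nhds_unique h1 (h2.congr' ?_)
  filter_upwards [self_mem_nhdsWithin] with s hs
  exact (hZ.laplace_flow hα hB x t hs).symm

/-- The strict inequality asks for a zero before `t`. Absorption gives one implication; for the
other, continuity of w ↦ P_x(Z_w = 0) shows that first reaching 0 exactly at `t` has probability
zero. -/
lemma ae_extinctionTime_lt_iff (x : ℝ≥0) {t : ℝ≥0} (ht : 0 < t) :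
    ∀ᵐ ω ∂P x, extinctionTime Z ω < t ↔ Z t ω = 0 := by
  obtain ⟨u, hu⟩ := hZ.exists_isCumulant
  have := hZ.isMarkovKernel
  obtain ⟨w, -, hw, hlim⟩ := exists_seq_strictMono_tendsto' ht
  have hm : ∀ t, MeasurableSet {ω | Z t ω = 0} :=
    fun t => hZ.measurable t (measurableSet_singleton 0)
  have h1 : (⋃ n, {ω | Z (w n) ω = 0} : Set Ω) =ᵐ[P x] {ω | Z t ω = 0} := by
    refine ae_eq_of_ae_subset_of_measure_ge ?_ ?_
      (MeasurableSet.iUnion fun n => hm _).nullMeasurableSet (measure_ne_top _ _)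
    · filter_upwards [hZ.absorbed x] with ω hω h
      obtain ⟨n, hn⟩ := mem_iUnion.1 h
      exact hω _ _ (hw n).2.le hn
    · have h2 : Tendsto (fun n => P x {ω | Z (w n) ω = 0}) atTop
          (𝓝 (P x {ω | Z t ω = 0})) := by
        rw [hZ.measure_eq_zero hα hB x ht]
        simp_rw [fun n => hZ.measure_eq_zero hα hB x (hw n).1]
        refine ENNReal.tendsto_ofReal ((Real.continuous_exp.tendsto _).comp
          ((((hasDerivAt_flow hα hB hu (show (0 : ℝ) < t from ht)).continuousAt.tendsto.comp
            (NNReal.tendsto_coe.2 hlim)).const_mul _).neg))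
      exact le_of_tendsto' h2 fun n => measure_mono (subset_iUnion (fun n => {ω | Z (w n) ω = 0}) n)
  filter_upwards [hZ.absorbed x, h1.mem_iff] with ω hω h
  constructor
  · intro hlt
    obtain ⟨r, hr⟩ := iInf_lt_iff.1 hlt
    obtain ⟨hr0, hrt⟩ := iInf_lt_iff.1 hr
    exact hω r t (by exact_mod_cast hrt.le) hr0.2
  · intro h0
    obtain ⟨n, hn⟩ := mem_iUnion.1 (h.2 h0)
    exact (iInf₂_le (w n) ⟨(hw n).1, hn⟩).trans_lt (by exact_mod_cast (hw n).2)

/-- Markov property at `T`: given Z_T, extinction by time `T + q` has probability exp(-v(q) Z_T). -/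
lemma measure_inter_eq_zero (x T : ℝ≥0) {q : ℝ≥0} (hq : 0 < q) {A : Set ℝ≥0}
    (hA : MeasurableSet A) :
    P x (Z T ⁻¹' A ∩ {ω | Z (T + q) ω = 0}) =
      ENNReal.ofReal (∫ ω in Z T ⁻¹' A, Real.exp (-B.flow q * Z T ω) ∂P x) := by
  obtain ⟨u, hu⟩ := hZ.exists_isCumulant
  have := hZ.isMarkovKernel
  have hA' : MeasurableSet {p : Iic T → ℝ≥0 | p ⟨T, self_mem_Iic⟩ ∈ A} :=
    measurable_pi_apply _ hA
  have h := hZ.markov x T q _ {0} hA' (measurableSet_singleton 0)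
  rw [ofReal_integral_eq_lintegral_ofReal
    (integrable_exp_neg_mul (μ := (P x).restrict (Z T ⁻¹' A)) (hZ.measurable T)
      (flow_pos hα hB hu (show (0 : ℝ) < q from hq)).le)
    (.of_forall fun _ => (Real.exp_pos _).le)]
  refine h.trans (lintegral_congr fun ω => ?_)
  refine (hZ.measure_eq_zero hα hB (Z T ω) hq).trans ?_
  rw [mul_comm, neg_mul]

lemma measure_extinction_inter (x T : ℝ≥0) {q s : ℝ≥0} (hq : 0 < q) (hs : 0 < s)
    {A : Set ℝ≥0} (hA : MeasurableSet A) :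
    P x ({ω | ((T + q : ℝ≥0) : ℝ≥0∞) ≤ extinctionTime Z ω ∧
        extinctionTime Z ω < ((T + q + s : ℝ≥0) : ℝ≥0∞)} ∩ Z T ⁻¹' A) =
      ENNReal.ofReal ((∫ ω in Z T ⁻¹' A, Real.exp (-B.flow (q + s) * Z T ω) ∂P x) -
        ∫ ω in Z T ⁻¹' A, Real.exp (-B.flow q * Z T ω) ∂P x) := by
  have := hZ.isMarkovKernel
  have hqs : 0 < q + s := by positivity
  have hm : ∀ t, MeasurableSet {ω | Z t ω = 0} :=
    fun t => hZ.measurable t (measurableSet_singleton 0)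
  have hAm := hZ.measurable T hA
  have h1 : ({ω | ((T + q : ℝ≥0) : ℝ≥0∞) ≤ extinctionTime Z ω ∧
        extinctionTime Z ω < ((T + q + s : ℝ≥0) : ℝ≥0∞)} ∩ Z T ⁻¹' A : Set Ω) =ᵐ[P x]
      ((Z T ⁻¹' A ∩ {ω | Z (T + (q + s)) ω = 0}) \ (Z T ⁻¹' A ∩ {ω | Z (T + q) ω = 0}) :
        Set Ω) := by
    refine eventuallyEq_set.2 ?_
    filter_upwards [hZ.ae_extinctionTime_lt_iff hα hB x (show 0 < T + q by positivity),
      hZ.ae_extinctionTime_lt_iff hα hB x (show 0 < T + q + s by positivity)] with ω h1 h2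
    simp only [mem_inter_iff, Set.mem_sdiff, mem_ofPred_eq, ← add_assoc, ← h1, ← h2, ← not_lt]
    tauto
  have h2 : (Z T ⁻¹' A ∩ {ω | Z (T + q) ω = 0} : Set Ω) ≤ᵐ[P x]
      (Z T ⁻¹' A ∩ {ω | Z (T + (q + s)) ω = 0} : Set Ω) := by
    filter_upwards [hZ.absorbed x] with ω hω h
    exact ⟨h.1, hω _ _ (by gcongr; exact le_self_add) h.2⟩
  rw [measure_congr h1, measure_sdiff' _ (hAm.inter (hm _)).nullMeasurableSet (measure_ne_top _ _),
    measure_congr (union_ae_eq_left_iff_ae_subset.2 h2),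
    hZ.measure_inter_eq_zero hα hB x T hq hA, hZ.measure_inter_eq_zero hα hB x T hqs hA,
    ← ENNReal.ofReal_sub _ (integral_nonneg fun _ => (Real.exp_pos _).le), NNReal.coe_add]

lemma exists_isLawGivenExtinctionAt {x q t : ℝ≥0} (hx : 0 < x) (hq : 0 < q) (hqt : q < t) :
    ∃ ν : ProbabilityMeasure ℝ≥0, IsLawGivenExtinctionAt Z P x q t ν ∧
      ∀ m, 0 ≤ m → ∫ y : ℝ≥0, Real.exp (-m * y) ∂(ν : Measure ℝ≥0) =
        (∫ ω, Z (t - q) ω * Real.exp (-(B.flow q + m) * Z (t - q) ω) ∂P x) /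
          ∫ ω, Z (t - q) ω * Real.exp (-B.flow q * Z (t - q) ω) ∂P x := by
  obtain ⟨u, hu⟩ := hZ.exists_isCumulant
  have := hZ.isMarkovKernel
  have hqR : (0 : ℝ) < q := hq
  have hv := flow_pos hα hB hu hqR
  have hψ := B.psi_pos hα hB hv
  have hpos : 0 < ∫ ω, Z (t - q) ω * Real.exp (-B.flow q * Z (t - q) ω) ∂P x := by
    rw [hZ.integral_mul_exp_flow hα hB x _ hqR]
    have h1 := B.psi_pos hα hB (flow_pos hα hB hu (add_pos_of_nonneg_of_pos (t - q).coe_nonneg hqR))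
    have : (0 : ℝ) < x := hx
    positivity
  obtain ⟨ν, hν, hlap⟩ := exists_biased_law (hZ.measurable (t - q)) hv hpos
  refine ⟨ν, fun A hA => ?_, hlap⟩
  rw [hν A hA]
  have hcoe : Tendsto ((↑) : ℝ≥0 → ℝ) (𝓝[>] 0) (𝓝[>] 0) := by
    refine tendsto_nhdsWithin_iff.2 ⟨(NNReal.continuous_coe.tendsto' 0 0 rfl).mono_left
      nhdsWithin_le_nhds, ?_⟩
    filter_upwards [self_mem_nhdsWithin] with s hs using hs
  -- Numerator and denominator of the conditional probability are increments in `s` of Laplace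
  -- integrals. After division by `s` they converge to derivatives, whose common factor ψ(v(q))
  -- cancels.
  have hN := (hZ.hasDerivAt_integral_exp_flow hα hB (μ := (P x).restrict (Z (t - q) ⁻¹' A))
    (t - q) hqR).tendsto_slope_zero_right.comp hcoe
  have hD := (hZ.hasDerivAt_integral_exp_flow hα hB (μ := P x)
    (t - q) hqR).tendsto_slope_zero_right.comp hcoe
  have hlim := ENNReal.tendsto_ofReal (hN.div hD (mul_pos hψ hpos).ne')
  rw [mul_div_mul_left _ _ hψ.ne'] at hlim
  refine hlim.congr' ?_
  filter_upwards [self_mem_nhdsWithin] with s (hs : 0 < s)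
  have hs' : (0 : ℝ) < s := hs
  have htq : t = t - q + q := (tsub_add_cancel_of_le hqt.le).symm
  have e1 := hZ.measure_extinction_inter hα hB x (t - q) hq hs hA
  have e2 := hZ.measure_extinction_inter hα hB x (t - q) hq hs MeasurableSet.univ
  rw [← htq] at e1 e2
  rw [preimage_univ, inter_univ, Measure.restrict_univ] at e2
  have hlt : 0 < (∫ ω, Real.exp (-B.flow (q + s) * Z (t - q) ω) ∂P x) -
      ∫ ω, Real.exp (-B.flow q * Z (t - q) ω) ∂P x := by
    rw [hZ.laplace_flow hα hB _ _ hqR, hZ.laplace_flow hα hB _ _ (add_pos hqR hs'), sub_pos,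
      Real.exp_lt_exp, neg_lt_neg_iff]
    have h0 : (0 : ℝ) ≤ (t - q : ℝ≥0) := (t - q).coe_nonneg
    have := strictAntiOn_flow hα hB hu (show ((t - q : ℝ≥0) : ℝ) + q ∈ Ioi 0 by simp; linarith)
      (show ((t - q : ℝ≥0) : ℝ) + (q + s) ∈ Ioi 0 by simp; linarith) (by linarith)
    have hx' : (0 : ℝ) < x := hx
    gcongr
  rw [cond_apply' (hZ.measurable _ hA), e1, e2, ← ENNReal.ofReal_inv_of_pos hlt,
    ← ENNReal.ofReal_mul (inv_nonneg.2 hlt.le)]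
  congr 1
  simp only [Pi.div_apply, Function.comp_apply, smul_eq_mul]
  rw [mul_div_mul_left _ _ (inv_pos.2 hs').ne', div_eq_inv_mul]

end IsCBProcess

/-! ### The limiting Laplace transforms -/

namespace BranchingMechanism

variable {B : BranchingMechanism} (hα : 0 ≤ B.α) (hB : B.GreyCondition)
include hα hB

lemma tendsto_greyIntegral_zero {u : ℝ → ℝ → ℝ} (hu : B.IsCumulant u) :
    Tendsto B.greyIntegral (𝓝[>] 0) atTop := by
  refine tendsto_atTop.2 fun M => ?_
  have hM : 0 < max M 1 := by positivity
  filter_upwards [self_mem_nhdsWithin,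
    mem_nhdsWithin_of_mem_nhds (Iio_mem_nhds (flow_pos hα hB hu hM))] with m hm hm'
  refine (le_max_left M 1).trans ?_
  rw [← not_lt, ← flow_lt_iff hα hB hu hM hm, not_lt]
  exact le_of_lt hm'

/-- If `exp(α t) ψ(u_t(∞))` tends to `w`, then this is the Laplace transform at `m` of the limit
law of the `Q`-process. -/
def limitLaplace (B : BranchingMechanism) (w m : ℝ) : ℝ :=
  w / B.psi m * Real.exp (-(B.α * B.greyIntegral m))

/-- With t = φ(m) → ∞, the transform equals w divided by exp(α t) ψ(v(t)). -/
lemma tendsto_limitLaplace_zero {u : ℝ → ℝ → ℝ} (hu : B.IsCumulant u) {w : ℝ} (hw : 0 < w)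
    (h : Tendsto (fun t => Real.exp (B.α * t) * B.psi (B.flow t)) atTop (𝓝 w)) :
    Tendsto (B.limitLaplace w) (𝓝[>] 0) (𝓝 1) := by
  have h1 := (tendsto_const_nhds (x := w)).div
    (h.comp (tendsto_greyIntegral_zero hα hB hu)) hw.ne'
  rw [div_self hw.ne'] at h1
  refine h1.congr' ?_
  filter_upwards [self_mem_nhdsWithin] with m hm
  simp only [Pi.div_apply, Function.comp_apply]
  rw [flow_greyIntegral hα hB hm, limitLaplace, Real.exp_neg]
  field_simp

lemma tendsto_limitLaplace_atTop (hα' : 0 < B.α) {w : ℝ} (hw : 0 ≤ w) :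
    Tendsto (B.limitLaplace w) atTop (𝓝 0) := by
  have h1 : Tendsto (fun m => w / (B.α * m)) atTop (𝓝 0) :=
    tendsto_const_nhds.div_atTop (tendsto_id.const_mul_atTop hα')
  refine squeeze_zero' ?_ ?_ h1
  · filter_upwards [eventually_gt_atTop 0] with m hm
    have := B.psi_pos hα hB hm
    rw [limitLaplace]
    positivity
  · filter_upwards [eventually_gt_atTop 0] with m hm
    have h2 := B.psi_pos hα hB hm
    have h3 : 0 < B.α * B.greyIntegral m := mul_pos hα' (greyIntegral_pos hα hB hm)
    calc B.limitLaplace w m ≤ w / B.psi m * 1 := by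
          rw [limitLaplace]
          gcongr
          exact Real.exp_le_one_iff.2 (by linarith)
      _ ≤ w / (B.α * m) := by
          rw [mul_one]
          gcongr
          rw [psi_eq]
          linarith [B.excess_nonneg m]

/-- The Laplace transform of `V_q`. -/
def laplaceV (B : BranchingMechanism) (q m : ℝ) : ℝ :=
  B.psi (B.flow q) / B.psi (B.flow q + m) *
    Real.exp (B.α * (q - B.greyIntegral (B.flow q + m)))

omit hα hB in
lemma continuousAt_psi {m : ℝ} (hm : 0 < m) : ContinuousAt B.psi m :=
  B.continuousOn_psi.continuousAt (Ici_mem_nhds hm)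

lemma tendsto_laplaceV_zero {u : ℝ → ℝ → ℝ} (hu : B.IsCumulant u) {q : ℝ} (hq : 0 < q) :
    Tendsto (B.laplaceV q) (𝓝[>] 0) (𝓝 1) := by
  have hv := flow_pos hα hB hu hq
  have hψ := B.psi_pos hα hB hv
  have h0 : ContinuousAt (fun m => B.flow q + m) 0 := by fun_prop
  have h1 : ContinuousAt (fun m => B.psi (B.flow q + m)) 0 :=
    ContinuousAt.comp' (f := fun m => B.flow q + m)
      (by rw [add_zero]; exact continuousAt_psi hv) h0
  have h2 : ContinuousAt (fun m => B.greyIntegral (B.flow q + m)) 0 :=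
    ContinuousAt.comp' (f := fun m => B.flow q + m)
      (by rw [add_zero]; exact (hasDerivAt_greyIntegral hα hB hv).continuousAt) h0
  have h3 : ContinuousAt (B.laplaceV q) 0 := by
    refine ContinuousAt.mul (continuousAt_const.div h1 ?_) (by fun_prop)
    rw [add_zero]
    exact hψ.ne'
  have h4 : B.laplaceV q 0 = 1 := by
    rw [laplaceV, add_zero, greyIntegral_flow hα hB hu hq, div_self hψ.ne']
    simp
  have h5 := h3.tendsto
  rw [h4] at h5
  exact h5.mono_left nhdsWithin_le_nhds

/-- As v(q) → 0, the denominator and the Grey integral are evaluated at m in the limit, while exp(α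
q) ψ(v(q)) → w. -/
lemma tendsto_laplaceV_atTop {u : ℝ → ℝ → ℝ} (hu : B.IsCumulant u) {w : ℝ}
    (h : Tendsto (fun t => Real.exp (B.α * t) * B.psi (B.flow t)) atTop (𝓝 w))
    {m : ℝ} (hm : 0 < m) :
    Tendsto (fun q => B.laplaceV q m) atTop (𝓝 (B.limitLaplace w m)) := by
  have h0 : Tendsto (fun q => B.flow q + m) atTop (𝓝 m) := by
    simpa using ((tendsto_flow_atTop hα hB hu).mono_right nhdsWithin_le_nhds).add_const m
  have h1 := (continuousAt_psi (B := B) hm).tendsto.comp h0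
  have h2 := (hasDerivAt_greyIntegral hα hB hm).continuousAt.tendsto.comp h0
  have h3 := (h.div h1 (B.psi_pos hα hB hm).ne').mul
    ((Real.continuous_exp.tendsto _).comp (h2.const_mul B.α).neg)
  refine h3.congr fun q => ?_
  simp only [Pi.div_apply, Function.comp_apply, laplaceV]
  rw [mul_sub, sub_eq_add_neg, Real.exp_add]
  ring

end BranchingMechanism

/-! ### Convergence of the conditioned laws and of the Q-process -/

namespace IsCBProcess

open BranchingMechanism

variable {B : BranchingMechanism} {Ω : Type*} [MeasurableSpace Ω] {Z : ℝ≥0 → Ω → ℝ≥0}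
  {P : Kernel ℝ≥0 Ω} (hα : 0 ≤ B.α) (hB : B.GreyCondition) (hZ : IsCBProcess B Z P)
include hα hB hZ

lemma integral_mul_exp (x t : ℝ≥0) {m : ℝ} (hm : 0 < m) :
    ∫ ω, Z t ω * Real.exp (-m * Z t ω) ∂P x =
      x * (B.psi (B.flow (t + B.greyIntegral m)) / B.psi m) *
        Real.exp (-(x * B.flow (t + B.greyIntegral m))) := by
  have := hZ.integral_mul_exp_flow hα hB x t (greyIntegral_pos hα hB hm)
  rwa [flow_greyIntegral hα hB hm] at this

omit hα hB in
lemma integral_exp_QProcess {x : ℝ≥0} {Ω' : Type*} [MeasurableSpace Ω'] {Q : Measure Ω'}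
    {Y : ℝ≥0 → Ω' → ℝ≥0} (hY : IsQProcess B.α Z P x Y Q) (t : ℝ≥0) (m : ℝ) :
    ∫ ω, Real.exp (-m * Y t ω) ∂Q =
      Real.exp (B.α * t) / x * ∫ ω, Z t ω * Real.exp (-m * Z t ω) ∂P x := by
  have hYm := hY.measurable t
  have hZm := hZ.measurable t
  let f : Ω → ℝ≥0∞ := fun ω => ENNReal.ofReal (Z t ω * Real.exp (B.α * t) / x)
  have hf : Measurable f := by fun_prop
  have hmap : Q.map (Y t) = ((P x).withDensity f).map (Z t) := by
    ext C hC
    have hC' : MeasurableSet {p : Iic t → ℝ≥0 | p ⟨t, self_mem_Iic⟩ ∈ C} :=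
      measurable_pi_apply _ hC
    rw [Measure.map_apply hYm hC, Measure.map_apply hZm hC, withDensity_apply _ (hZm hC)]
    exact hY.law t _ hC'
  calc _ = ∫ y : ℝ≥0, Real.exp (-m * y) ∂Q.map (Y t) := by
        rw [integral_map hYm.aemeasurable (by fun_prop)]
    _ = _ := by
        rw [hmap, integral_map hZm.aemeasurable (by fun_prop),
          integral_withDensity_eq_integral_toReal_smul hf
          (.of_forall fun _ => ENNReal.ofReal_lt_top), ← integral_const_mul]
        congr 1
        ext ω
        rw [ENNReal.toReal_ofReal (by positivity), smul_eq_mul]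
        ring

/-- No sign is imposed on `w`, so one statement serves both w > 0 and w = 0. -/
lemma tendsto_integral_exp_QProcess {x : ℝ≥0} (hx : 0 < x) {Ω' : Type*} [MeasurableSpace Ω']
    {Q : Measure Ω'} {Y : ℝ≥0 → Ω' → ℝ≥0} (hY : IsQProcess B.α Z P x Y Q) {w : ℝ}
    (h : Tendsto (fun t => Real.exp (B.α * t) * B.psi (B.flow t)) atTop (𝓝 w))
    {m : ℝ} (hm : 0 < m) :
    Tendsto (fun t => ∫ ω, Real.exp (-m * Y t ω) ∂Q) atTop (𝓝 (B.limitLaplace w m)) := by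
  obtain ⟨u, hu⟩ := hZ.exists_isCumulant
  have hT : Tendsto (fun t : ℝ≥0 => (t : ℝ) + B.greyIntegral m) atTop atTop :=
    tendsto_atTop_add_const_right _ _ (NNReal.tendsto_coe_atTop.2 tendsto_id)
  have h1 := h.comp hT
  have h2 := ((tendsto_flow_atTop hα hB hu).mono_right nhdsWithin_le_nhds).comp hT
  have h3 := (Real.continuous_exp.tendsto _).comp (h2.const_mul (x : ℝ)).neg
  have h4 := ((h1.div_const (B.psi m)).mul_const
    (Real.exp (-(B.α * B.greyIntegral m)))).mul h3
  rw [mul_zero, neg_zero, Real.exp_zero, mul_one] at h4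
  refine h4.congr fun t => ?_
  have hx' : (x : ℝ) ≠ 0 := by exact_mod_cast hx.ne'
  simp only [Function.comp_apply]
  rw [hZ.integral_exp_QProcess hY, hZ.integral_mul_exp hα hB x t hm, mul_add, Real.exp_add,
    Real.exp_neg]
  have := (Real.exp_pos (B.α * B.greyIntegral m)).ne'
  field_simp

/-- The convergence of the conditional Laplace transforms to that of `V_q`. -/
lemma tendsto_laplaceV {x q : ℝ≥0} (hx : 0 < x) (hq : 0 < q) {w : ℝ} (hw : 0 < w)
    (h : Tendsto (fun t => Real.exp (B.α * t) * B.psi (B.flow t)) atTop (𝓝 w))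
    {m : ℝ} (hm : 0 < m) :
    Tendsto (fun t : ℝ≥0 =>
        (∫ ω, Z (t - q) ω * Real.exp (-(B.flow q + m) * Z (t - q) ω) ∂P x) /
          ∫ ω, Z (t - q) ω * Real.exp (-B.flow q * Z (t - q) ω) ∂P x)
      atTop (𝓝 (B.laplaceV q m)) := by
  obtain ⟨u, hu⟩ := hZ.exists_isCumulant
  have hq' : (0 : ℝ) < q := hq
  have hx' : (x : ℝ) ≠ 0 := by exact_mod_cast hx.ne'
  have hv := flow_pos hα hB hu hq'
  have hvm : 0 < B.flow q + m := by positivity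
  have hsub : Tendsto (fun t : ℝ≥0 => ((t - q : ℝ≥0) : ℝ)) atTop atTop :=
    NNReal.tendsto_coe_atTop.2 (tendsto_atTop.2 fun b => by
      filter_upwards [eventually_ge_atTop (b + q)] with t ht using le_tsub_of_add_le_right ht)
  have hT := fun r : ℝ => tendsto_atTop_add_const_right _ r hsub
  set s := B.greyIntegral (B.flow q + m) with hs
  have hE : ∀ r : ℝ, Tendsto (fun t : ℝ≥0 =>
      Real.exp (-(x * B.flow ((t - q : ℝ≥0) + r)))) atTop (𝓝 1) := by
    intro r
    have h2 := ((tendsto_flow_atTop hα hB hu).mono_right nhdsWithin_le_nhds).comp (hT r)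
    have h3 := (Real.continuous_exp.tendsto _).comp (h2.const_mul (x : ℝ)).neg
    rw [mul_zero, neg_zero, Real.exp_zero] at h3
    exact h3
  have h1 := (((h.comp (hT s)).div (h.comp (hT q)) hw.ne').mul
    ((hE s).div (hE q) one_ne_zero)).const_mul (B.laplaceV q m)
  -- Positivity of `w` makes the ratio of the two shifted values of exp(α t) ψ(v(t)) tend to 1.
  rw [div_self hw.ne', div_self one_ne_zero, mul_one, mul_one] at h1
  refine h1.congr fun t => ?_
  have hT0 : (0 : ℝ) ≤ (t - q : ℝ≥0) := (t - q).coe_nonneg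
  have e1 := B.psi_pos hα hB (flow_pos hα hB hu (add_pos_of_nonneg_of_pos hT0 hq'))
  have e2 := B.psi_pos hα hB hv
  have e3 := B.psi_pos hα hB hvm
  rw [hZ.integral_mul_exp hα hB x _ hvm, hZ.integral_mul_exp hα hB x _ hv,
    greyIntegral_flow hα hB hu hq', ← hs]
  simp only [Pi.div_apply, Function.comp_apply, laplaceV, ← hs]
  rw [mul_sub, Real.exp_sub, mul_add, mul_add, Real.exp_add, Real.exp_add]
  have e4 := (Real.exp_pos (B.α * s)).ne'
  have e5 := (Real.exp_pos (B.α * q)).ne'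
  have e6 := (Real.exp_pos (B.α * (t - q : ℝ≥0))).ne'
  field_simp

lemma exists_isLawOfV {q : ℝ≥0} (hq : 0 < q) {w : ℝ} (hw : 0 < w)
    (h : Tendsto (fun t => Real.exp (B.α * t) * B.psi (B.flow t)) atTop (𝓝 w)) :
    ∃ V : ProbabilityMeasure ℝ≥0, IsLawOfV Z P q V ∧
      ∀ m, 0 < m → ∫ y : ℝ≥0, Real.exp (-m * y) ∂(V : Measure ℝ≥0) = B.laplaceV q m := by
  obtain ⟨u, hu⟩ := hZ.exists_isCumulant
  have hex : ∀ x : ℝ≥0, 0 < x → ∃ K : ℝ≥0 → ProbabilityMeasure ℝ≥0,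
      (∀ t, q < t → IsLawGivenExtinctionAt Z P x q t (K t)) ∧
      ∀ m, 0 < m → Tendsto (fun t => ∫ y : ℝ≥0, Real.exp (-m * y) ∂(K t : Measure ℝ≥0))
        atTop (𝓝 (B.laplaceV q m)) := by
    intro x hx
    choose! K hK1 hK2 using fun t (hqt : q < t) =>
      hZ.exists_isLawGivenExtinctionAt hα hB hx hq hqt
    refine ⟨K, hK1, fun m hm => (hZ.tendsto_laplaceV hα hB hx hq hw h hm).congr' ?_⟩
    filter_upwards [eventually_gt_atTop q] with t ht
    exact (hK2 t ht m hm.le).symm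
  -- The limit transform is free of `x`, so the law built from x = 1 serves every starting point.
  obtain ⟨K, -, hK⟩ := hex 1 one_pos
  obtain ⟨V, -, hV⟩ := exists_tendsto_of_tendsto_laplace hK (tendsto_laplaceV_zero hα hB hu hq)
  refine ⟨V, fun x hx => ?_, hV⟩
  obtain ⟨K, hK1, hK2⟩ := hex x hx
  refine ⟨K, hK1, tendsto_of_tendsto_laplace fun m hm => ?_⟩
  rw [hV m hm]
  exact hK2 m hm

lemma exists_isLawOfVInfty {w : ℝ} (hw : 0 < w)
    (h : Tendsto (fun t => Real.exp (B.α * t) * B.psi (B.flow t)) atTop (𝓝 w)) :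
    ∃ V : ProbabilityMeasure ℝ≥0, IsLawOfVInfty Z P V ∧
      ∀ m, 0 < m → ∫ y : ℝ≥0, Real.exp (-m * y) ∂(V : Measure ℝ≥0) = B.limitLaplace w m := by
  obtain ⟨u, hu⟩ := hZ.exists_isCumulant
  choose! V hV1 hV2 using fun q (hq : 0 < q) => hZ.exists_isLawOfV hα hB hq hw h
  have hlim : ∀ m, 0 < m → Tendsto
      (fun q => ∫ y : ℝ≥0, Real.exp (-m * y) ∂(V q : Measure ℝ≥0))
      atTop (𝓝 (B.limitLaplace w m)) := fun m hm => by
    refine ((tendsto_laplaceV_atTop hα hB hu h hm).comp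
      (NNReal.tendsto_coe_atTop.2 tendsto_id)).congr' ?_
    filter_upwards [eventually_gt_atTop 0] with q hq
    exact (hV2 q hq m hm).symm
  obtain ⟨Vinf, h1, h2⟩ := exists_tendsto_of_tendsto_laplace hlim
    (tendsto_limitLaplace_zero hα hB hu hw h)
  exact ⟨Vinf, ⟨V, hV1, h1⟩, h2⟩

end IsCBProcess

/-! ### Positivity of the limit, escape to infinity, and the theorem -/

lemma measure_Ioi_eq_one_of_tendsto_laplace (V : ProbabilityMeasure ℝ≥0)
    (h : Tendsto (fun m => ∫ y : ℝ≥0, Real.exp (-m * y) ∂(V : Measure ℝ≥0)) atTop (𝓝 0)) :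
    (V : Measure ℝ≥0) (Ioi 0) = 1 := by
  have h1 : (V : Measure ℝ≥0).real {0} ≤ 0 := by
    refine ge_of_tendsto h ?_
    filter_upwards [eventually_ge_atTop 0] with m hm
    rw [← integral_indicator_one (measurableSet_singleton 0)]
    refine integral_mono ((integrable_const 1).indicator (measurableSet_singleton 0))
      (integrable_exp_neg_mul_nnreal _ hm) fun y => ?_
    by_cases hy : y = 0
    · simp [hy]
    · rw [indicator_of_notMem (by simpa using hy)]
      exact (Real.exp_pos _).le
  have h2 : (V : Measure ℝ≥0) {0} = 0 :=
    (measureReal_eq_zero_iff).1 (le_antisymm h1 measureReal_nonneg)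
  have h3 : (Ioi 0 : Set ℝ≥0) = {0}ᶜ := by ext y; simp [pos_iff_ne_zero]
  rw [h3, prob_compl_eq_one_iff (measurableSet_singleton 0), h2]

/-- Chernoff bound: Q(Y_t ≤ M) ≤ exp(M) E[exp(-Y_t)]. -/
lemma tendsto_measure_lt_of_tendsto_laplace {Ω' : Type*} [MeasurableSpace Ω'] {Q : Measure Ω'}
    [IsProbabilityMeasure Q] {Y : ℝ≥0 → Ω' → ℝ≥0} (hY : ∀ t, Measurable (Y t))
    (h : Tendsto (fun t => ∫ ω, Real.exp (-1 * Y t ω) ∂Q) atTop (𝓝 0)) (M : ℝ≥0) :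
    Tendsto (fun t => Q {ω | M < Y t ω}) atTop (𝓝 1) := by
  have hm : ∀ t, MeasurableSet {ω | Y t ω ≤ M} := fun t => measurableSet_le (hY t) (by fun_prop)
  have h1 : ∀ t, Q.real {ω | Y t ω ≤ M} ≤ Real.exp M * ∫ ω, Real.exp (-1 * Y t ω) ∂Q := by
    intro t
    rw [← integral_indicator_one (hm t), ← integral_const_mul]
    refine integral_mono ((integrable_const 1).indicator (hm t))
      ((integrable_exp_neg_mul (hY t) zero_le_one).const_mul _) fun ω => ?_
    by_cases hy : Y t ω ≤ M
    · rw [indicator_of_mem (by exact hy), ← Real.exp_add]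
      have : (Y t ω : ℝ) ≤ M := by exact_mod_cast hy
      exact Real.one_le_exp (by linarith)
    · rw [indicator_of_notMem (by exact hy)]
      positivity
  have h2 : Tendsto (fun t => Q.real {ω | Y t ω ≤ M}) atTop (𝓝 0) := by
    have h3 := h.const_mul (Real.exp M)
    rw [mul_zero] at h3
    exact squeeze_zero (fun _ => measureReal_nonneg) h1 h3
  have h3 : Tendsto (fun t => Q {ω | Y t ω ≤ M}) atTop (𝓝 0) := by
    simpa using ENNReal.tendsto_ofReal h2
  have h4 := ENNReal.Tendsto.sub (tendsto_const_nhds (x := (1 : ℝ≥0∞))) h3 (.inl (by simp))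
  rw [tsub_zero] at h4
  refine h4.congr fun t => ?_
  rw [← prob_compl_eq_one_sub (hm t)]
  congr 1
  ext ω
  simp

end

theorem mainTheorem8 (B : BranchingMechanism) (hα : 0 ≤ B.α) (hB : B.GreyCondition)
    {Ω : Type*} [MeasurableSpace Ω] (Z : ℝ≥0 → Ω → ℝ≥0) (P : Kernel ℝ≥0 Ω)
    (hZ : IsCBProcess B Z P) :
    (B.LLogLCondition →
      ∃ Vinf : ProbabilityMeasure ℝ≥0, IsLawOfVInfty Z P Vinf ∧
        (Vinf : Measure ℝ≥0) (Ioi 0) = 1 ∧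
        ∀ x : ℝ≥0, 0 < x → ∀ (Ω' : Type*) [MeasurableSpace Ω'] (Q : Measure Ω')
          [IsProbabilityMeasure Q] (Y : ℝ≥0 → Ω' → ℝ≥0), IsQProcess B.α Z P x Y Q →
            TendstoInDistribution Y atTop (id : ℝ≥0 → ℝ≥0) (fun _ => Q) (Vinf : Measure ℝ≥0)) ∧
    (¬ B.LLogLCondition →
      ∀ x : ℝ≥0, 0 < x → ∀ (Ω' : Type*) [MeasurableSpace Ω'] (Q : Measure Ω')
        [IsProbabilityMeasure Q] (Y : ℝ≥0 → Ω' → ℝ≥0), IsQProcess B.α Z P x Y Q →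
          ∀ M : ℝ≥0, Tendsto (fun t => Q {ω | M < Y t ω}) atTop (𝓝 1)) := by
  obtain ⟨u, hu⟩ := hZ.exists_isCumulant
  constructor
  · intro hL
    obtain ⟨w, hw, h⟩ := BranchingMechanism.exists_tendsto_exp_mul_psi_flow hα hB hu hL
    obtain ⟨Vinf, hV, hlap⟩ := hZ.exists_isLawOfVInfty hα hB hw h
    refine ⟨Vinf, hV, ?_, fun x hx Ω' _ Q _ Y hY => ?_⟩
    · refine measure_Ioi_eq_one_of_tendsto_laplace Vinf
        ((BranchingMechanism.tendsto_limitLaplace_atTop hα hB hL.1 hw.le).congr' ?_)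
      filter_upwards [eventually_gt_atTop 0] with m hm
      exact (hlap m hm).symm
    · refine ⟨fun t => (hY.measurable t).aemeasurable, aemeasurable_id, ?_⟩
      refine tendsto_of_tendsto_laplace fun m hm => ?_
      have h1 := hZ.tendsto_integral_exp_QProcess hα hB hx hY h hm
      simp only [ProbabilityMeasure.coe_mk, Measure.map_id, hlap m hm]
      refine h1.congr fun t => ?_
      rw [integral_map (hY.measurable t).aemeasurable (by fun_prop)]
  · intro hL x hx Ω' _ Q _ Y hY
    refine tendsto_measure_lt_of_tendsto_laplace hY.measurable ?_
    have h1 := hZ.tendsto_integral_exp_QProcess hα hB hx hY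
      (BranchingMechanism.tendsto_exp_mul_psi_flow_zero hα hB hu hL) one_pos
    -- With w = 0 the limit transform is identically zero.
    simpa [BranchingMechanism.limitLaplace] using h1
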